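/- Let $M$ be a connected, oriented smooth surface and let $\Sigma\subset TM$ be a (not necessarily reversible) smooth Finsler structure: $\Sigma$ is a smooth embedded hypersurface of $TM$, the basepoint projection $\pi:\Sigma\to M$ is a surjective submersion, and each fibre $\Sigma_x=\Sigma\cap T_xM$ is a smooth closed strictly convex curve with nowhere vanishing curvature in $T_xM$ whose convex hull contains $0_x$ in its interior. A $\Sigma$-curve (unit speed curve) is a smooth curve $\gamma$ in $M$ with $\gamma'(t)\in\Sigma$ for all $t$. Let $(\omega_1,\omega_2,\omega_3)$ be Cartan's canonical coframing on $\Sigma$, i.e. the coframing determined by: $\omega_1\wedge\omega_2$ is a positive multiple of the $\pi$-pullback of any positive $2$-form on $M$; $(\gamma')^*\omega_2=0$ and $(\gamma')^*\omega_1=dt$ for every $\Sigma$-curve $\gamma$; $d\omega_1\wedge\omega_2=0$; $\omega_1\wedge d\omega_1=\omega_2\wedge d\omega_2$; $d\omega_1=\omega_3\wedge\omega_2$ and $\omega_3\wedge d\omega_2=0$. It satisfies $$d\omega_1=-\omega_2\wedge\omega_3,\qquad d\omega_2=-\omega_3\wedge(\omega_1-I\,\omega_2),\qquad d\omega_3=-(K\,\omega_1-J\,\omega_3)\wedge\omega_2$$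 for unique functions $I,J,K$ on $\Sigma$. Unit speed geodesics are the $\Sigma$-curves $\gamma$ with $(\gamma')^*\omega_3=0$. Let $X_1$ be the vector field on $\Sigma$ with $\omega_1(X_1)=1$, $\omega_2(X_1)=\omega_3(X_1)=0$. Assume that $K\equiv 1$ and that $\Sigma$ is geodesically complete, i.e. $X_1$ is complete (forward and backward), and let $\Psi_t:\Sigma\to\Sigma$ be its flow (the geodesic flow). A Finsler isometry is a diffeomorphism $\phi:M\to M$ whose derivative $\phi'$ maps $\Sigma$ onto $\Sigma$. Then: 1. There exists a unique orientation-reversing Finsler isometry $\alpha:M\to M$ such that $\alpha'(u)=\Psi_\pi(u)$ for all $u\in\Sigma$. 2. For any $p\in M$, every unit speed geodesic leaving $p$ passes through $\alpha(p)$ at distance $\pi$: every unit speed geodesic $\gamma$ defined on an open interval containing $0$ with $\gamma(0)=p$ extends to a unit speed geodesic defined on $\mathbb R$ that takes the value $\alpha(p)$ at time $\pi$ (in particular $\gamma(\pi)=\alpha(p)$ if $\gamma(\pi)$ is defined). -/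

import Mathlib

open scoped Manifold ContDiff Topology

noncomputable section

namespace Finsler

/-! ### Differential forms, evaluated on smooth vector fields -/

section Forms

variable {n : ℕ} (S : Type*) [TopologicalSpace S] [ChartedSpace (EuclideanSpace ℝ (Fin n)) S]

/-- Vector fields (no regularity) on an `n`-manifold. -/
abbrev VField : Type _ := (u : S) → TangentSpace (𝓡 n) u

/-- `1`-forms (no regularity) on an `n`-manifold. -/
abbrev OneForm : Type _ := (u : S) → TangentSpace (𝓡 n) u →L[ℝ] ℝ

variable {S}

/-- `V` is a `C^∞` vector field. -/
def VField.IsSmooth [IsManifold (𝓡 n) ∞ S] (V : VField (n := n) S) : Prop :=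
  ContMDiff (𝓡 n) (𝓡 n).tangent ∞ (fun u => (⟨u, V u⟩ : TangentBundle (𝓡 n) S))

/-- `θ` is a `C^∞` `1`-form: it is smooth as a function on the tangent bundle. -/
def OneForm.IsSmooth [IsManifold (𝓡 n) ∞ S] (θ : OneForm (n := n) S) : Prop :=
  ContMDiff (𝓡 n).tangent 𝓘(ℝ, ℝ) ∞ (fun v : TangentBundle (𝓡 n) S => θ v.proj v.snd)

/-- The derivative `V f` of the function `f` along the vector field `V`. -/
def VField.apply (V : VField (n := n) S) (f : S → ℝ) (u : S) : ℝ :=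
  mfderiv (𝓡 n) 𝓘(ℝ, ℝ) f u (V u)

/-- The exterior derivative of a `1`-form, evaluated on two vector fields:
`dθ(V, W) = V (θ W) - W (θ V) - θ [V, W]`. -/
def OneForm.d (θ : OneForm (n := n) S) (V W : VField (n := n) S) (u : S) : ℝ :=
  V.apply (fun q => θ q (W q)) u - W.apply (fun q => θ q (V q)) u
    - θ u (VectorField.mlieBracket (𝓡 n) V W u)

/-- The wedge product of two `1`-forms, evaluated on two vector fields. -/
def OneForm.wedge (θ η : OneForm (n := n) S) (V W : VField (n := n) S) (u : S) : ℝ :=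
  θ u (V u) * η u (W u) - θ u (W u) * η u (V u)

/-- The wedge product `θ ∧ B` of a `1`-form and a `2`-form (given by its values on pairs of
vector fields), evaluated on three vector fields. -/
def OneForm.wedge₂ (θ : OneForm (n := n) S)
    (B : VField (n := n) S → VField (n := n) S → S → ℝ)
    (U V W : VField (n := n) S) (u : S) : ℝ :=
  θ u (U u) * B V W u + θ u (V u) * B W U u + θ u (W u) * B U V u

end Forms

/-! ### Oriented surfaces -/

/-- A smooth nowhere vanishing `2`-form on a surface.  It represents the orientation for which it
is positive; two such forms represent the same orientation iff they differ by a positive factor. -/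
structure PositiveTwoForm (M : Type*) [TopologicalSpace M]
    [ChartedSpace (EuclideanSpace ℝ (Fin 2)) M] [IsManifold (𝓡 2) ∞ M] where
  toForm : (x : M) → TangentSpace (𝓡 2) x [⋀^Fin 2]→ₗ[ℝ] ℝ
  ne_zero : ∀ x, toForm x ≠ 0
  smooth : ∀ V W : VField (n := 2) M, V.IsSmooth → W.IsSmooth →
    ContMDiff (𝓡 2) 𝓘(ℝ, ℝ) ∞ (fun x => toForm x ![V x, W x])

/-! ### Finsler structures -/

section Structure

variable (M : Type*) [TopologicalSpace M] [ChartedSpace (EuclideanSpace ℝ (Fin 2)) M]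
  [IsManifold (𝓡 2) ∞ M]

variable {M} in
/-- The set of vectors of `Σ ⊆ TM` based at `x`. -/
def fiberOf (carrier : Set (TangentBundle (𝓡 2) M)) (x : M) : Set (TangentSpace (𝓡 2) x) :=
  {v | (⟨x, v⟩ : TangentBundle (𝓡 2) M) ∈ carrier}

/-- A (not necessarily reversible) Finsler structure on a surface, given by its set `Σ` of unit
vectors: a smooth embedded hypersurface of `TM`, mapped submersively onto `M`, whose
fibres are closed convex curves around the origin with nowhere vanishing curvature. -/
structure FinslerStructure where
  carrier : Set (TangentBundle (𝓡 2) M)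
  [chartedSpace : ChartedSpace (EuclideanSpace ℝ (Fin 3)) carrier]
  [isManifold : IsManifold (𝓡 3) ∞ carrier]
  embedding : Manifold.IsSmoothEmbedding (𝓡 3) (𝓡 2).tangent ∞
    (Subtype.val : carrier → TangentBundle (𝓡 2) M)
  submersion : Manifold.IsSubmersion (𝓡 3) (𝓡 2) ∞ (fun u : carrier => u.1.proj)
  surjective : Function.Surjective (fun u : carrier => u.1.proj)
  isCompact_fiber : ∀ x, IsCompact (fiberOf carrier x)
  /-- each fibre is the boundary of its convex hull -/
  frontier_convexHull : ∀ x, frontier (convexHull ℝ (fiberOf carrier x)) = fiberOf carrier x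
  strictConvex : ∀ x, StrictConvex ℝ (convexHull ℝ (fiberOf carrier x))
  zero_mem : ∀ x, (0 : TangentSpace (𝓡 2) x) ∈ interior (convexHull ℝ (fiberOf carrier x))
  /-- the fibres have nowhere vanishing curvature -/
  curved : ∀ (x : M) (c : ℝ → EuclideanSpace ℝ (Fin 2)), ContDiff ℝ ∞ c →
    (∀ s, (⟨x, c s⟩ : TangentBundle (𝓡 2) M) ∈ carrier) →
    ∀ s, deriv c s ≠ 0 → LinearIndependent ℝ ![deriv c s, deriv (deriv c) s]

attribute [instance] FinslerStructure.chartedSpace FinslerStructure.isManifold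

end Structure

variable {M : Type*} [TopologicalSpace M] [ChartedSpace (EuclideanSpace ℝ (Fin 2)) M]
  [IsManifold (𝓡 2) ∞ M]

namespace FinslerStructure

variable (F : FinslerStructure M)

/-- The basepoint projection `π : Σ → M`. -/
def proj (u : F.carrier) : M := u.1.proj

/-- `γ` is a smooth curve on the open set `s` of times with velocity in `Σ` (a `Σ`-curve, or unit
speed curve), and `c` is its tangential lift `γ'` to `Σ`. -/
structure IsTangentialLift (γ : ℝ → M) (c : ℝ → F.carrier) (s : Set ℝ) : Prop where
  smooth : ContMDiffOn 𝓘(ℝ, ℝ) (𝓡 2) ∞ γ s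
  smooth_lift : ContMDiffOn 𝓘(ℝ, ℝ) (𝓡 3) ∞ c s
  lift_eq : ∀ t ∈ s, (c t : TangentBundle (𝓡 2) M) =
    ⟨γ t, mfderiv 𝓘(ℝ, ℝ) (𝓡 2) γ t (1 : ℝ)⟩

/-- The velocity of a curve in `Σ`. -/
def velocity (c : ℝ → F.carrier) (t : ℝ) : TangentSpace (𝓡 3) (c t) :=
  mfderiv 𝓘(ℝ, ℝ) (𝓡 3) c t (1 : ℝ)

/-- A smooth coframing of `Σ`: three smooth `1`-forms that form a basis of each cotangent space. -/
structure Coframing where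
  ω₁ : OneForm (n := 3) F.carrier
  ω₂ : OneForm (n := 3) F.carrier
  ω₃ : OneForm (n := 3) F.carrier
  smooth₁ : ω₁.IsSmooth
  smooth₂ : ω₂.IsSmooth
  smooth₃ : ω₃.IsSmooth
  bijective : ∀ u, Function.Bijective
    (((ω₁ u).prod ((ω₂ u).prod (ω₃ u)) : TangentSpace (𝓡 3) u →L[ℝ] ℝ × ℝ × ℝ))

/-- `η` is Cartan's canonical coframing of the Finsler structure `Σ` on the oriented surface `M`:
these properties are its definition, and they determine the three forms uniquely. -/
structure IsCanonicalCoframing (Ω : PositiveTwoForm M) (η : F.Coframing) : Prop where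
  /-- `ω₁ ∧ ω₂` is a positive multiple of the pullback of any positive `2`-form -/
  positive : ∀ u : F.carrier, ∃ r : ℝ, 0 < r ∧ ∀ v w : TangentSpace (𝓡 3) u,
    η.ω₁ u v * η.ω₂ u w - η.ω₁ u w * η.ω₂ u v =
      r * Ω.toForm (F.proj u)
        ![mfderiv (𝓡 3) (𝓡 2) F.proj u v, mfderiv (𝓡 3) (𝓡 2) F.proj u w]
  /-- the tangential lift of any `Σ`-curve satisfies `(γ')^* ω₂ = 0` and `(γ')^* ω₁ = dt` -/
  lift : ∀ (γ : ℝ → M) (c : ℝ → F.carrier) (s : Set ℝ), IsOpen s → F.IsTangentialLift γ c s →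
    ∀ t ∈ s, η.ω₂ (c t) (F.velocity c t) = 0 ∧ η.ω₁ (c t) (F.velocity c t) = 1
  /-- `dω₁ ∧ ω₂ = 0` -/
  dω₁_wedge_ω₂ : ∀ U V W : VField (n := 3) F.carrier, U.IsSmooth → V.IsSmooth → W.IsSmooth →
    ∀ u, η.ω₂.wedge₂ η.ω₁.d U V W u = 0
  /-- `ω₁ ∧ dω₁ = ω₂ ∧ dω₂` -/
  ω₁_wedge_dω₁ : ∀ U V W : VField (n := 3) F.carrier, U.IsSmooth → V.IsSmooth → W.IsSmooth →
    ∀ u, η.ω₁.wedge₂ η.ω₁.d U V W u = η.ω₂.wedge₂ η.ω₂.d U V W u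
  /-- `dω₁ = ω₃ ∧ ω₂` -/
  dω₁ : ∀ V W : VField (n := 3) F.carrier, V.IsSmooth → W.IsSmooth →
    ∀ u, η.ω₁.d V W u = η.ω₃.wedge η.ω₂ V W u
  /-- `ω₃ ∧ dω₂ = 0` -/
  ω₃_wedge_dω₂ : ∀ U V W : VField (n := 3) F.carrier, U.IsSmooth → V.IsSmooth → W.IsSmooth →
    ∀ u, η.ω₃.wedge₂ η.ω₂.d U V W u = 0

namespace Coframing

variable {F} (η : F.Coframing)

/-- Cartan's structure equations
`dω₁ = -ω₂ ∧ ω₃`, `dω₂ = -ω₃ ∧ (ω₁ - I ω₂)`, `dω₃ = -(K ω₁ - J ω₃) ∧ ω₂`. -/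
structure StructureEquations (I J K : F.carrier → ℝ) : Prop where
  dω₁ : ∀ V W : VField (n := 3) F.carrier, V.IsSmooth → W.IsSmooth →
    ∀ u, η.ω₁.d V W u = -η.ω₂.wedge η.ω₃ V W u
  dω₂ : ∀ V W : VField (n := 3) F.carrier, V.IsSmooth → W.IsSmooth →
    ∀ u, η.ω₂.d V W u = -η.ω₃.wedge (fun q => η.ω₁ q - I q • η.ω₂ q) V W u
  dω₃ : ∀ V W : VField (n := 3) F.carrier, V.IsSmooth → W.IsSmooth →
    ∀ u, η.ω₃.d V W u = -OneForm.wedge (fun q => K q • η.ω₁ q - J q • η.ω₃ q) η.ω₂ V W u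

/-- The Finsler-Gauss curvature function in the structure equations of `η` is `K`. -/
def HasCurvature (K : F.carrier → ℝ) : Prop :=
  ∃ I J : F.carrier → ℝ, η.StructureEquations I J K

/-- The vector field `X₁` of the dual frame: `ω₁ X₁ = 1`, `ω₂ X₁ = ω₃ X₁ = 0`. For the canonical
coframing, it generates the geodesic flow. -/
def X₁ : VField (n := 3) F.carrier := fun u =>
  (Equiv.ofBijective _ (η.bijective u)).symm (1, 0, 0)

/-- Geodesic completeness: the vector field `X₁` is complete, in both time directions. -/
def IsComplete : Prop :=
  ∀ u : F.carrier, ∃ c : ℝ → F.carrier, c 0 = u ∧ IsMIntegralCurve c η.X₁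

variable {η} in
/-- The flow `Ψ_t : Σ → Σ` of the complete vector field `X₁`. -/
def flow (h : η.IsComplete) (t : ℝ) (u : F.carrier) : F.carrier :=
  Classical.choose (h u) t

/-- `γ` is a unit speed geodesic on the open set `s` of times: a `Σ`-curve whose tangential lift
satisfies `(γ')^* ω₃ = 0`. -/
def IsUnitSpeedGeodesicOn (γ : ℝ → M) (s : Set ℝ) : Prop :=
  ∃ c : ℝ → F.carrier, F.IsTangentialLift γ c s ∧ ∀ t ∈ s, η.ω₃ (c t) (F.velocity c t) = 0

end Coframing

/-- A Finsler isometry: a diffeomorphism whose derivative maps `Σ` onto `Σ`. -/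
def IsIsometry (φ : M ≃ₘ⟮𝓡 2, 𝓡 2⟯ M) : Prop :=
  ∀ v : TangentBundle (𝓡 2) M, tangentMap (𝓡 2) (𝓡 2) φ v ∈ F.carrier ↔ v ∈ F.carrier

end FinslerStructure

/-- `φ` reverses the orientation: the pullback of a positive `2`-form is a negative multiple of
it at every point. -/
def IsOrientationReversing (Ω : PositiveTwoForm M) (φ : M ≃ₘ⟮𝓡 2, 𝓡 2⟯ M) : Prop :=
  ∀ x : M, ∃ r : ℝ, r < 0 ∧ ∀ v w : TangentSpace (𝓡 2) x,
    Ω.toForm (φ x) ![mfderiv (𝓡 2) (𝓡 2) φ x v, mfderiv (𝓡 2) (𝓡 2) φ x w] =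
      r * Ω.toForm x ![v, w]

end Finsler

end

/-! Let X₁, X₂, X₃ be the frame dual to ω₁, ω₂, ω₃. For K = 1 the structure equations say [X₁, X₂] =
X₃ and [X₁, X₃] = -X₂; the functions I and J only multiply ω₃ ∧ ω₂ and so do not enter brackets with
X₁. Hence the differential of Ψ_t carries X₁ to X₁ and rotates the plane of X₂, X₃ by the angle t
(`IsRotationFrame.hasMFDerivAt_flow`). At t = π the form ω₁ pulls back to itself, while ω₂ and ω₃
change sign.

The vertical vectors of Σ → M are those with ω₁ = ω₂ = 0 (`mfderiv_proj_eq_zero_iff`), so Ψ_π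
preserves them and the base point of Ψ_π(u) is locally constant along the fibres. The fibres are
connected, being boundaries of bounded plane convex sets around 0, so this base point descends to a
smooth map α of M (`exists_factor_of_vertical`, `exists_baseMap`), with inverse coming from Ψ_{-π}.
The projection sends X₁ at u to the vector u itself (`tangentMap_proj_X₁`), and X₁ is invariant
under its flow; therefore α' = Ψ_π on Σ, and α is an isometry. It reverses orientation because ω₁ ∧
ω₂ changes sign. Base points alone determine α, which gives uniqueness. Geodesics are projections of
flow lines, so every geodesic leaving p is at α(p) at time π.

The analysis of the flow is direct: the rotated frame solves the equation linearised along a flow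
line, a Gronwall estimate shows that it is the derivative of the local flow, and smoothness of Ψ_t
follows by bootstrapping from the formula for its differential (`contMDiffOn_of_hasMFDerivAt_sum`).
-/

noncomputable section

namespace Finsler
open Set Metric VectorField

/-! ### Derivative of a local flow in a normed space. -/

section FlowDerivative

variable {E : Type*} [NormedAddCommGroup E] [NormedSpace ℝ E]

/-- Second order estimate for the dependence of a solution on its initial value: `a`, `b` solve
`x' = f x`, and `J` solves the equation linearised along `a`. -/
theorem norm_sub_sub_le_of_linearised {f : E → E} {f' : E → E →L[ℝ] E} {s : Set E} {K : NNReal}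
    {C T : ℝ} (hC : 0 ≤ C) (hT : 0 ≤ T) (hLip : LipschitzOnWith K f s)
    (hf' : ∀ x ∈ s, ‖f' x‖ ≤ K)
    (hquad : ∀ x ∈ s, ∀ y ∈ s, ‖f y - f x - f' x (y - x)‖ ≤ C * ‖y - x‖ ^ 2)
    {a b J : ℝ → E}
    (ha : ∀ t ∈ Icc 0 T, a t ∈ s ∧ HasDerivAt a (f (a t)) t)
    (hb : ∀ t ∈ Icc 0 T, b t ∈ s ∧ HasDerivAt b (f (b t)) t)
    (hJ : ∀ t ∈ Icc 0 T, HasDerivAt J (f' (a t) (J t)) t)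
    (h0 : J 0 = b 0 - a 0) :
    ‖b T - a T - J T‖ ≤
      gronwallBound 0 K (C * (‖b 0 - a 0‖ * Real.exp (K * T)) ^ 2) T := by
  -- Gronwall for the two solutions; the linearisation error below is then quadratic in the initial
  -- distance.
  have hdist : ∀ t ∈ Icc 0 T, ‖b t - a t‖ ≤ ‖b 0 - a 0‖ * Real.exp (K * T) := by
    intro t ht
    have h := dist_le_of_trajectories_ODE_of_mem (v := fun _ => f) (s := fun _ => s) (K := K)
      (f := b) (g := a) (a := 0) (b := T) (δ := ‖b 0 - a 0‖) (fun _ _ => hLip)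
      (fun t ht => (hb t ht).2.continuousAt.continuousWithinAt)
      (fun t ht => (hb t (Ico_subset_Icc_self ht)).2.hasDerivWithinAt)
      (fun t ht => (hb t (Ico_subset_Icc_self ht)).1)
      (fun t ht => (ha t ht).2.continuousAt.continuousWithinAt)
      (fun t ht => (ha t (Ico_subset_Icc_self ht)).2.hasDerivWithinAt)
      (fun t ht => (ha t (Ico_subset_Icc_self ht)).1) (by rw [dist_eq_norm]) t ht
    rw [dist_eq_norm, sub_zero] at h
    refine h.trans ?_
    gcongr
    exact ht.2
  have hder : ∀ t ∈ Icc 0 T, HasDerivAt (fun t => b t - a t - J t)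
      (f (b t) - f (a t) - f' (a t) (J t)) t := fun t ht =>
    ((hb t ht).2.sub (ha t ht).2).sub (hJ t ht)
  have := norm_le_gronwallBound_of_norm_deriv_right_le (f := fun t => b t - a t - J t)
    (f' := fun t => f (b t) - f (a t) - f' (a t) (J t)) (δ := 0) (K := K)
    (ε := C * (‖b 0 - a 0‖ * Real.exp (K * T)) ^ 2) (a := 0) (b := T)
    (fun t ht => (hder t ht).continuousAt.continuousWithinAt)
    (fun t ht => (hder t (Ico_subset_Icc_self ht)).hasDerivWithinAt) (by simp [h0])
    (fun t ht => by
      have ht' := Ico_subset_Icc_self ht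
      -- The remainder satisfies the linearised equation up to the Taylor error of `f` between `a t`
      -- and `b t`.
      have e : f (b t) - f (a t) - f' (a t) (J t) =
          f' (a t) (b t - a t - J t) + (f (b t) - f (a t) - f' (a t) (b t - a t)) := by
        simp only [map_sub]; abel
      rw [e]
      refine (norm_add_le _ _).trans (add_le_add ?_ ?_)
      · exact ((f' (a t)).le_opNorm _).trans
          (mul_le_mul_of_nonneg_right (hf' _ (ha t ht').1) (norm_nonneg _))
      · refine (hquad _ (ha t ht').1 _ (hb t ht').1).trans ?_
        gcongr
        exact hdist t ht') T ⟨hT, le_rfl⟩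
  simpa using this

/-- Linearity in the forcing term pulls the square of the initial distance out of the bound, leaving
a constant independent of the nearby initial value. -/
theorem gronwallBound_zero_eq_mul (K ε x : ℝ) :
    gronwallBound 0 K ε x = ε * gronwallBound 0 K 1 x := by
  unfold gronwallBound
  split_ifs <;> ring

/-- Derivative of a local flow in forward time, given a fundamental solution `P` of the equation
linearised along the solution starting at `x₀`. -/
theorem hasFDerivAt_flow_of_nonneg {f : E → E} {f' : E → E →L[ℝ] E} {s : Set E} {K : NNReal}
    {C T : ℝ} (hC : 0 ≤ C) (hT : 0 ≤ T) (hLip : LipschitzOnWith K f s)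
    (hf' : ∀ x ∈ s, ‖f' x‖ ≤ K)
    (hquad : ∀ x ∈ s, ∀ y ∈ s, ‖f y - f x - f' x (y - x)‖ ≤ C * ‖y - x‖ ^ 2)
    {α : E → ℝ → E} {x₀ : E}
    (hα : ∀ᶠ x in 𝓝 x₀, α x 0 = x ∧ ∀ t ∈ Icc 0 T, α x t ∈ s ∧ HasDerivAt (α x) (f (α x t)) t)
    {P : ℝ → E →L[ℝ] E} (hP0 : ∀ h, P 0 h = h)
    (hP : ∀ t ∈ Icc 0 T, ∀ h, HasDerivAt (fun τ => P τ h) (f' (α x₀ t) (P t h)) t) :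
    HasFDerivAt (fun x => α x T) (P T) x₀ := by
  obtain ⟨h00, h01⟩ := hα.self_of_nhds
  set D : ℝ := C * Real.exp (K * T) ^ 2 * gronwallBound 0 K 1 T
  have hbd : ∀ᶠ x in 𝓝 x₀, ‖α x T - α x₀ T - P T (x - x₀)‖ ≤ D * ‖x - x₀‖ ^ 2 := by
    filter_upwards [hα] with x hx
    have := norm_sub_sub_le_of_linearised hC hT hLip hf' hquad (a := α x₀) (b := α x)
      (J := fun τ => P τ (x - x₀)) h01 hx.2 (fun t ht => hP t ht _) (by rw [hP0, hx.1, h00])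
    rw [gronwallBound_zero_eq_mul, hx.1, h00] at this
    calc _ ≤ _ := this
      _ = _ := by ring
  rw [hasFDerivAt_iff_isLittleO]
  have h1 : (fun x => α x T - α x₀ T - P T (x - x₀)) =O[𝓝 x₀] fun x => ‖x - x₀‖ ^ 2 :=
    Asymptotics.IsBigO.of_bound D (by simpa using hbd)
  refine h1.trans_isLittleO ?_
  have h2 : (fun x : E => ‖x‖ ^ 2) =o[𝓝 0] fun x => x := by
    simpa using Asymptotics.isLittleO_norm_pow_id (E' := E) one_lt_two
  exact h2.comp_tendsto (by
    have : Filter.Tendsto (fun x => x - x₀) (𝓝 x₀) (𝓝 (x₀ - x₀)) :=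
      (continuous_id.sub continuous_const).tendsto _
    simpa using this)

/-- Derivative of a local flow, given a fundamental solution `P` of the equation linearised along
the solution starting at `x₀`. -/
theorem hasFDerivAt_flow {f : E → E} {f' : E → E →L[ℝ] E} {s : Set E} {K : NNReal}
    {C ε : ℝ} (hC : 0 ≤ C) (hLip : LipschitzOnWith K f s)
    (hf' : ∀ x ∈ s, ‖f' x‖ ≤ K)
    (hquad : ∀ x ∈ s, ∀ y ∈ s, ‖f y - f x - f' x (y - x)‖ ≤ C * ‖y - x‖ ^ 2)
    {α : E → ℝ → E} {x₀ : E}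
    (hα : ∀ᶠ x in 𝓝 x₀, α x 0 = x ∧
      ∀ t ∈ Ioo (-ε) ε, α x t ∈ s ∧ HasDerivAt (α x) (f (α x t)) t)
    {P : ℝ → E →L[ℝ] E} (hP0 : ∀ h, P 0 h = h)
    (hP : ∀ t ∈ Ioo (-ε) ε, ∀ h, HasDerivAt (fun τ => P τ h) (f' (α x₀ t) (P t h)) t)
    {t : ℝ} (ht : t ∈ Ioo (-ε) ε) :
    HasFDerivAt (fun x => α x t) (P t) x₀ := by
  rcases le_total 0 t with h | h
  · have hsub : Icc 0 t ⊆ Ioo (-ε) ε := fun τ hτ =>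
      ⟨by linarith [hτ.1, ht.2], hτ.2.trans_lt ht.2⟩
    exact hasFDerivAt_flow_of_nonneg hC h hLip hf' hquad
      (hα.mono fun x hx => ⟨hx.1, fun τ hτ => hx.2 τ (hsub hτ)⟩) hP0
      (fun τ hτ => hP τ (hsub hτ))
  · have hsub : ∀ τ ∈ Icc 0 (-t), -τ ∈ Ioo (-ε) ε := fun τ hτ =>
      ⟨by linarith [hτ.2, ht.1], by linarith [hτ.1, ht.1, ht.2]⟩
    -- Negative times are positive times for the reversed field `-f`.
    have := hasFDerivAt_flow_of_nonneg (f := fun x => -f x) (f' := fun x => -f' x) (s := s) (K := K)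
      (α := fun x τ => α x (-τ)) (P := fun τ => P (-τ)) (T := -t) (x₀ := x₀) hC (by linarith)
      hLip.neg (by simpa using hf')
      (fun x hx y hy => by
        have e : -f y - -f x - (-f' x) (y - x) = -(f y - f x - f' x (y - x)) := by
          simp only [neg_apply]; abel
        rw [e, norm_neg]; exact hquad x hx y hy)
      (hα.mono fun x hx => ⟨by simpa using hx.1, fun τ hτ => by
        obtain ⟨h1, h2⟩ := hx.2 _ (hsub τ hτ)
        refine ⟨h1, ?_⟩
        simpa [Function.comp_def] using h2.scomp τ (hasDerivAt_neg τ)⟩)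
      (by simpa using hP0)
      (fun τ hτ w => by
        simpa [Function.comp_def] using (hP _ (hsub τ hτ) w).scomp τ (hasDerivAt_neg τ))
    simpa using this

/-- `C` is a local Lipschitz constant of the derivative. The quadratic bound is the mean value
inequality on a segment, which is why the neighbourhood is taken to be a ball. -/
theorem exists_lipschitz_quadratic_nhds {f : E → E} {x₀ : E} (hf : ContDiffAt ℝ 2 f x₀) {U : Set E}
    (hU : U ∈ 𝓝 x₀) : ∃ s ∈ 𝓝 x₀, s ⊆ U ∧ ∃ (K : NNReal) (C : ℝ), 0 ≤ C ∧ LipschitzOnWith K f s ∧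
      (∀ x ∈ s, ‖fderiv ℝ f x‖ ≤ K) ∧
      ∀ x ∈ s, ∀ y ∈ s, ‖f y - f x - fderiv ℝ f x (y - x)‖ ≤ C * ‖y - x‖ ^ 2 := by
  have hf' : ContDiffAt ℝ 1 (fderiv ℝ f) x₀ := hf.fderiv_right (by norm_num)
  obtain ⟨C, u, hu, hC⟩ := hf'.exists_lipschitzOnWith
  have hK : ∀ᶠ x in 𝓝 x₀, ‖fderiv ℝ f x‖ ≤ ‖fderiv ℝ f x₀‖ + 1 :=
    (hf'.continuousAt.norm.eventually_lt continuousAt_const (lt_add_one _)).mono fun _ h => h.le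
  have hd : ∀ᶠ x in 𝓝 x₀, DifferentiableAt ℝ f x :=
    (hf.eventually (by simp)).mono fun x hx => hx.differentiableAt (by norm_num)
  obtain ⟨r, hr, hrs⟩ := Metric.mem_nhds_iff.1 (Filter.inter_mem (Filter.inter_mem hU hu)
    (Filter.inter_mem hK hd))
  have hd' : ∀ x ∈ ball x₀ r, DifferentiableAt ℝ f x := fun x hx => (hrs hx).2.2
  refine ⟨ball x₀ r, ball_mem_nhds _ hr, fun x hx => (hrs hx).1.1,
    ⟨‖fderiv ℝ f x₀‖ + 1, by positivity⟩, C, C.2, ?_, fun x hx => (hrs hx).2.1, ?_⟩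
  · exact (convex_ball x₀ r).lipschitzOnWith_of_nnnorm_fderiv_le hd' fun x hx => (hrs hx).2.1
  · intro x hx y hy
    have hseg : segment ℝ x y ⊆ ball x₀ r := (convex_ball x₀ r).segment_subset hx hy
    have := (convex_segment x y).norm_image_sub_le_of_norm_hasFDerivWithin_le' (f := f)
      (f' := fderiv ℝ f) (φ := fderiv ℝ f x) (C := C * ‖y - x‖)
      (fun z hz => (hd' z (hseg hz)).hasFDerivAt.hasFDerivWithinAt)
      (fun z hz => by
        refine (hC.norm_sub_le (hrs (hseg hz)).1.2 (hrs hx).1.2).trans ?_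
        gcongr
        exact norm_sub_le_of_mem_segment hz)
      (left_mem_segment ℝ x y) (right_mem_segment ℝ x y)
    calc _ ≤ _ := this
      _ = _ := by ring

/-- The Picard–Lindelöf flow is jointly continuous at `(x₀, 0)`, so one time `ε` keeps all nearby
solutions inside `s`. -/
theorem exists_local_flow [CompleteSpace E] {f : E → E} {x₀ : E} (hf : ContDiffAt ℝ 1 f x₀)
    {s : Set E} (hs : s ∈ 𝓝 x₀) : ∃ ε > (0 : ℝ), ∃ α : E → ℝ → E, ∀ᶠ x in 𝓝 x₀, α x 0 = x ∧
      ∀ t ∈ Ioo (-ε) ε, α x t ∈ s ∧ HasDerivAt (α x) (f (α x t)) t := by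
  obtain ⟨ε, hε, a, r, L, K, hr, hpl⟩ := IsPicardLindelof.of_contDiffAt_one hf
  obtain ⟨α, hα, hcont⟩ := (hpl 0).exists_forall_mem_closedBall_eq_hasDerivWithinAt_continuousOn
  have hα0 : α (x₀, 0) = x₀ := (hα x₀ (mem_closedBall_self r.2)).1
  have hcont' : ContinuousAt α (x₀, 0) := hcont.continuousAt
    (prod_mem_nhds (closedBall_mem_nhds _ hr) (Icc_mem_nhds (by linarith) (by linarith)))
  have hmem : α ⁻¹' s ∈ 𝓝 (x₀, (0 : ℝ)) := hcont' (by rwa [hα0])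
  rw [nhds_prod_eq, Filter.mem_prod_iff] at hmem
  obtain ⟨u, hu, v, hv, huv⟩ := hmem
  obtain ⟨δ, hδ, hδv⟩ := Metric.mem_nhds_iff.1 hv
  refine ⟨min δ ε, lt_min hδ hε, fun x t => α (x, t), ?_⟩
  filter_upwards [hu, closedBall_mem_nhds x₀ hr] with x hxu hxr
  refine ⟨(hα x hxr).1, fun t ht => ⟨huv ⟨hxu, hδv ?_⟩, ?_⟩⟩
  · rw [Real.ball_eq_Ioo]
    exact ⟨by linarith [ht.1, min_le_left δ ε], by linarith [ht.2, min_le_left δ ε]⟩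
  · have h1 : 0 - ε < t := by linarith [ht.1, min_le_right δ ε]
    have h2 : t < 0 + ε := by linarith [ht.2, min_le_right δ ε]
    exact ((hα x hxr).2 t ⟨h1.le, h2.le⟩).hasDerivAt (Icc_mem_nhds h1 h2)

/-- If `[f, g] = h` and `[f, h] = -g`, then the local flow of `f` rotates `g` and `h`. -/
theorem exists_local_flow_rotation [CompleteSpace E] {f g h : E → E} {U : Set E} (hU : IsOpen U)
    (hf : ContDiffOn ℝ 2 f U) (hg : DifferentiableOn ℝ g U) (hh : DifferentiableOn ℝ h U)
    (hfg : ∀ x ∈ U, fderiv ℝ g x (f x) - fderiv ℝ f x (g x) = h x)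
    (hfh : ∀ x ∈ U, fderiv ℝ h x (f x) - fderiv ℝ f x (h x) = -g x)
    {x₀ : E} (hx₀ : x₀ ∈ U) :
    ∃ ε > (0 : ℝ), ∃ α : E → ℝ → E, (∀ᶠ x in 𝓝 x₀, α x 0 = x ∧
      ∀ t ∈ Ioo (-ε) ε, α x t ∈ U ∧ HasDerivAt (α x) (f (α x t)) t) ∧
      ∀ᶠ x in 𝓝 x₀, ∀ t ∈ Ioo (-ε) ε, ∀ l₁ l₂ l₃ : E →L[ℝ] ℝ,
        (∀ w, l₁ w • f x + l₂ w • g x + l₃ w • h x = w) →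
        HasFDerivAt (fun y => α y t) (l₁.smulRight (f (α x t)) +
          l₂.smulRight (Real.cos t • g (α x t) - Real.sin t • h (α x t)) +
          l₃.smulRight (Real.sin t • g (α x t) + Real.cos t • h (α x t))) x := by
  have hf₀ : ContDiffAt ℝ 2 f x₀ := hf.contDiffAt (hU.mem_nhds hx₀)
  obtain ⟨s, hs, hsU, K, C, hC, hLip, hK, hquad⟩ :=
    exists_lipschitz_quadratic_nhds hf₀ (hU.mem_nhds hx₀)
  obtain ⟨ε, hε, α, hα⟩ := exists_local_flow (hf₀.of_le (by norm_num)) hs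
  refine ⟨ε, hε, α, hα.mono fun x hx => ⟨hx.1, fun t ht => ⟨hsU (hx.2 t ht).1, (hx.2 t ht).2⟩⟩, ?_⟩
  filter_upwards [hα.eventually_nhds] with x hx t ht l₁ l₂ l₃ hl
  have hx' := hx.self_of_nhds
  refine hasFDerivAt_flow (f' := fderiv ℝ f) hC hLip hK hquad hx
    (P := fun t => l₁.smulRight (f (α x t)) +
          l₂.smulRight (Real.cos t • g (α x t) - Real.sin t • h (α x t)) +
          l₃.smulRight (Real.sin t • g (α x t) + Real.cos t • h (α x t)))
    (fun w => by simpa [hx'.1] using hl w) (fun τ hτ w => ?_) ht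
  obtain ⟨hτs, hτd⟩ := hx'.2 τ hτ
  have hn : U ∈ 𝓝 (α x τ) := hU.mem_nhds (hsU hτs)
  have dF := ((hf.contDiffAt hn).differentiableAt (by norm_num)).hasFDerivAt.comp_hasDerivAt τ hτd
  have dG := (hg.differentiableAt hn).hasFDerivAt.comp_hasDerivAt τ hτd
  have dH := (hh.differentiableAt hn).hasFDerivAt.comp_hasDerivAt τ hτd
  have d1 := dF.const_smul (l₁ w)
  have d2 := (((Real.hasDerivAt_cos τ).smul dG).sub
    ((Real.hasDerivAt_sin τ).smul dH)).const_smul (l₂ w)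
  have d3 := (((Real.hasDerivAt_sin τ).smul dG).add
    ((Real.hasDerivAt_cos τ).smul dH)).const_smul (l₃ w)
  -- The bracket relations rewrite the derivatives of `g` and `h` along the flow as `Df g + h` and
  -- `Df h - g`. The extra terms cancel against the derivatives of `cos` and `sin`, so the rotated
  -- frame solves the linearised equation.
  have e1 := sub_eq_iff_eq_add.1 (hfg _ (hsU hτs))
  have e2 := sub_eq_iff_eq_add.1 (hfh _ (hsU hτs))
  refine ((d1.add d2).add d3).congr_deriv ?_
  simp only [Function.comp_def, e1, e2, add_apply,
    ContinuousLinearMap.smulRight_apply, map_add, map_smul, map_sub]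
  module

/-- A solution of the total differential equation `dg = ∑ i, θ i ⊗ Z i (g)` with smooth
coefficients is smooth. -/
theorem contDiffOn_of_hasFDerivAt_sum {E' ι : Type*} [NormedAddCommGroup E'] [NormedSpace ℝ E']
    [Fintype ι] {g : E → E'} {W : Set E} {W' : Set E'} (hW : IsOpen W) (hg : MapsTo g W W')
    {θ : ι → E → E →L[ℝ] ℝ} {Z : ι → E' → E'} (hθ : ∀ i, ContDiffOn ℝ ∞ (θ i) W)
    (hZ : ∀ i, ContDiffOn ℝ ∞ (Z i) W')
    (h : ∀ x ∈ W, HasFDerivAt g (∑ i, (θ i x).smulRight (Z i (g x))) x) :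
    ContDiffOn ℝ ∞ g W := by
  rw [contDiffOn_infty]
  intro n
  induction n with
  | zero =>
    exact contDiffOn_zero.2 fun x hx => (h x hx).continuousAt.continuousWithinAt
  | succ n ih =>
    push_cast
    rw [contDiffOn_succ_iff_fderiv_of_isOpen hW]
    refine ⟨fun x hx => (h x hx).differentiableAt.differentiableWithinAt, by simp, ?_⟩
    -- Bootstrapping: the right-hand side of the equation is as regular as `g`, so `g` gains one
    -- derivative.
    have : ContDiffOn ℝ n (fun x => ∑ i, (θ i x).smulRight (Z i (g x))) W :=
      ContDiffOn.sum fun i _ => ((hθ i).of_le (by exact_mod_cast le_top)).smulRight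
        (((hZ i).of_le (by exact_mod_cast le_top)).comp ih hg)
    exact this.congr fun x hx => (h x hx).fderiv

end FlowDerivative

/-! ### Vector fields, brackets and 1-forms in a chart. -/

section ChartExpressions

variable {E : Type*} [NormedAddCommGroup E] [NormedSpace ℝ E] {N : Type*} [TopologicalSpace N]
  [ChartedSpace E N]

/-- The expression of a vector field in the preferred chart at `q`. -/
def chartField (q : N) (V : (x : N) → TangentSpace 𝓘(ℝ, E) x) : E → E :=
  mpullback 𝓘(ℝ, E) 𝓘(ℝ, E) (extChartAt 𝓘(ℝ, E) q).symm V

/-- The expression of a `1`-form in the preferred chart at `q`. -/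
def chartForm (q : N) (θ : (x : N) → TangentSpace 𝓘(ℝ, E) x →L[ℝ] ℝ) (x : E) : E →L[ℝ] ℝ :=
  (θ ((extChartAt 𝓘(ℝ, E) q).symm x)).comp
    (mfderiv 𝓘(ℝ, E) 𝓘(ℝ, E) (extChartAt 𝓘(ℝ, E) q).symm x)

variable [IsManifold 𝓘(ℝ, E) ∞ N]

theorem contMDiffAt_extChartAt_symm' {q : N} {x : E} (hx : x ∈ (extChartAt 𝓘(ℝ, E) q).target) :
    ContMDiffAt 𝓘(ℝ, E) 𝓘(ℝ, E) ∞ (extChartAt 𝓘(ℝ, E) q).symm x :=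
  (contMDiffOn_extChartAt_symm q).contMDiffAt ((isOpen_extChartAt_target q).mem_nhds hx)

theorem mdifferentiableAt_extChartAt_symm' {q : N} {x : E}
    (hx : x ∈ (extChartAt 𝓘(ℝ, E) q).target) :
    MDifferentiableAt 𝓘(ℝ, E) 𝓘(ℝ, E) (extChartAt 𝓘(ℝ, E) q).symm x :=
  (contMDiffAt_extChartAt_symm' hx).mdifferentiableAt (by simp)

theorem isInvertible_mfderiv_extChartAt_symm' {q : N} {x : E}
    (hx : x ∈ (extChartAt 𝓘(ℝ, E) q).target) :
    (mfderiv 𝓘(ℝ, E) 𝓘(ℝ, E) (extChartAt 𝓘(ℝ, E) q).symm x).IsInvertible := by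
  have : IsManifold 𝓘(ℝ, E) 1 N := .of_le (n := ∞) (by norm_cast)
  have h := isInvertible_mfderivWithin_extChartAt_symm (I := 𝓘(ℝ, E)) hx
  rwa [modelWithCornersSelf_coe, range_id, mfderivWithin_univ] at h

theorem mfderiv_extChartAt_symm_mfderiv_extChartAt {q u : N}
    (hu : u ∈ (extChartAt 𝓘(ℝ, E) q).source) (w : TangentSpace 𝓘(ℝ, E) u) :
    mfderiv 𝓘(ℝ, E) 𝓘(ℝ, E) (extChartAt 𝓘(ℝ, E) q).symm (extChartAt 𝓘(ℝ, E) q u)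
      (mfderiv 𝓘(ℝ, E) 𝓘(ℝ, E) (extChartAt 𝓘(ℝ, E) q) u w) = w := by
  have : IsManifold 𝓘(ℝ, E) 1 N := .of_le (n := ∞) (by norm_cast)
  have h := mfderivWithin_extChartAt_symm_comp_mfderiv_extChartAt' (I := 𝓘(ℝ, E)) hu
  rw [modelWithCornersSelf_coe, range_id, mfderivWithin_univ] at h
  exact congrArg (fun L => L w) h

theorem mfderiv_extChartAt_mfderiv_extChartAt_symm {q : N} {x : E}
    (hx : x ∈ (extChartAt 𝓘(ℝ, E) q).target) (w : E) :
    mfderiv 𝓘(ℝ, E) 𝓘(ℝ, E) (extChartAt 𝓘(ℝ, E) q) ((extChartAt 𝓘(ℝ, E) q).symm x)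
      (mfderiv 𝓘(ℝ, E) 𝓘(ℝ, E) (extChartAt 𝓘(ℝ, E) q).symm x w) = w := by
  have : IsManifold 𝓘(ℝ, E) 1 N := .of_le (n := ∞) (by norm_cast)
  have h := mfderiv_extChartAt_comp_mfderivWithin_extChartAt_symm (I := 𝓘(ℝ, E)) hx
  rw [modelWithCornersSelf_coe, range_id, mfderivWithin_univ] at h
  exact congrArg (fun L => L w) h

theorem mfderiv_extChartAt_symm_chartField {q : N} (V : (x : N) → TangentSpace 𝓘(ℝ, E) x) {x : E}
    (hx : x ∈ (extChartAt 𝓘(ℝ, E) q).target) :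
    mfderiv 𝓘(ℝ, E) 𝓘(ℝ, E) (extChartAt 𝓘(ℝ, E) q).symm x (chartField (E := E) q V x) =
      V ((extChartAt 𝓘(ℝ, E) q).symm x) := by
  obtain ⟨e, he⟩ := isInvertible_mfderiv_extChartAt_symm' hx
  rw [chartField, mpullback_apply, ← he, ContinuousLinearMap.inverse_equiv]
  exact e.apply_symm_apply _

theorem mfderiv_extChartAt_eq_chartField {q u : N} (V : (x : N) → TangentSpace 𝓘(ℝ, E) x)
    (hu : u ∈ (extChartAt 𝓘(ℝ, E) q).source) :
    mfderiv 𝓘(ℝ, E) 𝓘(ℝ, E) (extChartAt 𝓘(ℝ, E) q) u (V u) =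
      chartField q V (extChartAt 𝓘(ℝ, E) q u) := by
  have hx := (extChartAt 𝓘(ℝ, E) q).map_source hu
  have h := mfderiv_extChartAt_symm_chartField V hx
  have h' := mfderiv_extChartAt_mfderiv_extChartAt_symm hx (chartField q V (extChartAt 𝓘(ℝ, E) q u))
  rw [h, (extChartAt 𝓘(ℝ, E) q).left_inv hu] at h'
  exact h'

theorem contDiffOn_chartField_of_contMDiffOn [CompleteSpace E] (q : N) {O : Set N} (hO : IsOpen O)
    {V : (x : N) → TangentSpace 𝓘(ℝ, E) x} (hV : ContMDiffOn 𝓘(ℝ, E) 𝓘(ℝ, E).tangent ∞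
      (fun x => (⟨x, V x⟩ : TangentBundle 𝓘(ℝ, E) N)) O) :
    ContDiffOn ℝ ∞ (chartField q V)
      ((extChartAt 𝓘(ℝ, E) q).target ∩ (extChartAt 𝓘(ℝ, E) q).symm ⁻¹' O) := fun x hx =>
  (contMDiffAt_vectorSpace_iff_contDiffAt.1 (ContMDiffAt.mpullback_vectorField_preimage
    (hV.contMDiffAt (hO.mem_nhds hx.2)) (contMDiffAt_extChartAt_symm' hx.1)
    (isInvertible_mfderiv_extChartAt_symm' hx.1) (by simp))).contDiffWithinAt

theorem contDiffOn_chartField [CompleteSpace E] (q : N) {V : (x : N) → TangentSpace 𝓘(ℝ, E) x}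
    (hV : ContMDiff 𝓘(ℝ, E) 𝓘(ℝ, E).tangent ∞ (fun x => (⟨x, V x⟩ : TangentBundle 𝓘(ℝ, E) N))) :
    ContDiffOn ℝ ∞ (chartField q V) (extChartAt 𝓘(ℝ, E) q).target := by
  simpa using contDiffOn_chartField_of_contMDiffOn q isOpen_univ hV.contMDiffOn

theorem lieBracket_chartField [CompleteSpace E] {q : N} {V W : (x : N) → TangentSpace 𝓘(ℝ, E) x}
    (hV : ContMDiff 𝓘(ℝ, E) 𝓘(ℝ, E).tangent ∞ (fun x => (⟨x, V x⟩ : TangentBundle 𝓘(ℝ, E) N)))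
    (hW : ContMDiff 𝓘(ℝ, E) 𝓘(ℝ, E).tangent ∞ (fun x => (⟨x, W x⟩ : TangentBundle 𝓘(ℝ, E) N)))
    {x : E} (hx : x ∈ (extChartAt 𝓘(ℝ, E) q).target) :
    fderiv ℝ (chartField q W) x (chartField q V x) -
      fderiv ℝ (chartField q V) x (chartField q W x) =
      chartField q (mlieBracket 𝓘(ℝ, E) V W) x := by
  have : IsManifold 𝓘(ℝ, E) (minSmoothness ℝ 2) N := .of_le (n := ∞) (by simp; norm_cast)
  have h := mpullback_mlieBracket (I := 𝓘(ℝ, E)) ((hV _).mdifferentiableAt (by simp))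
    ((hW _).mdifferentiableAt (by simp)) (contMDiffAt_extChartAt_symm' hx)
    (by simpa using (by norm_cast : (2 : WithTop ℕ∞) ≤ ∞))
  rw [← mlieBracketWithin_univ (V := mpullback _ _ _ V), mlieBracketWithin_eq_lieBracketWithin]
    at h
  exact (h.trans (congrFun lieBracketWithin_univ x)).symm

/-- On a fixed vector `w`, the coordinate form is `θ` composed with the tangent map of the inverse
chart along a constant field. -/
theorem contDiffOn_chartForm [FiniteDimensional ℝ E] (q : N)
    {θ : (x : N) → TangentSpace 𝓘(ℝ, E) x →L[ℝ] ℝ}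
    (hθ : ContMDiff 𝓘(ℝ, E).tangent 𝓘(ℝ, ℝ) ∞
      (fun v : TangentBundle 𝓘(ℝ, E) N => θ v.proj v.snd)) :
    ContDiffOn ℝ ∞ (chartForm q θ) (extChartAt 𝓘(ℝ, E) q).target := by
  rw [contDiffOn_clm_apply]
  intro w
  rw [← contMDiffOn_iff_contDiffOn]
  have h1 := (contMDiffOn_extChartAt_symm (I := 𝓘(ℝ, E)) (n := ∞) q).contMDiffOn_tangentMapWithin
    (m := ∞) (by simp) (isOpen_extChartAt_target q).uniqueMDiffOn
  have h2 : ContMDiff 𝓘(ℝ, E) 𝓘(ℝ, E).tangent ∞ (fun x : E => (⟨x, w⟩ : TangentBundle 𝓘(ℝ, E) E)) :=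
    contMDiff_vectorSpace_iff_contDiff.2 contDiff_const
  have h3 := hθ.comp_contMDiffOn (h1.comp h2.contMDiffOn (s := (extChartAt 𝓘(ℝ, E) q).target)
    fun x hx => hx)
  refine h3.congr fun x hx => ?_
  simp only [chartForm, Function.comp_def, tangentMapWithin,
    mfderivWithin_of_isOpen (isOpen_extChartAt_target q) hx]
  rfl

end ChartExpressions

/-! ### Differential of the flow of a rotation frame. -/

section RotationFlow

variable {E : Type*} [NormedAddCommGroup E] [NormedSpace ℝ E] {N : Type*} [TopologicalSpace N]
  [ChartedSpace E N]

/-- The linear map `T_u N → T_v N` that takes a frame `(X, Y, Z)` dual to `(θ₁, θ₂, θ₃)` to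
`(X, cos t Y - sin t Z, sin t Y + cos t Z)`. -/
def frameRotation (X Y Z : (x : N) → TangentSpace 𝓘(ℝ, E) x)
    (θ₁ θ₂ θ₃ : (x : N) → TangentSpace 𝓘(ℝ, E) x →L[ℝ] ℝ) (t : ℝ) (u v : N) :
    TangentSpace 𝓘(ℝ, E) u →L[ℝ] TangentSpace 𝓘(ℝ, E) v :=
  (θ₁ u).smulRight (X v) + (θ₂ u).smulRight (Real.cos t • Y v - Real.sin t • Z v) +
    (θ₃ u).smulRight (Real.sin t • Y v + Real.cos t • Z v)

theorem frameRotation_apply {X Y Z : (x : N) → TangentSpace 𝓘(ℝ, E) x}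
    {θ₁ θ₂ θ₃ : (x : N) → TangentSpace 𝓘(ℝ, E) x →L[ℝ] ℝ} {t : ℝ} {u v : N}
    (w : TangentSpace 𝓘(ℝ, E) u) :
    frameRotation X Y Z θ₁ θ₂ θ₃ t u v w = θ₁ u w • X v +
      θ₂ u w • (Real.cos t • Y v - Real.sin t • Z v) +
      θ₃ u w • (Real.sin t • Y v + Real.cos t • Z v) := rfl

theorem isMIntegralCurveOn_extChartAt_symm_comp [IsManifold 𝓘(ℝ, E) ∞ N]
    {X : (x : N) → TangentSpace 𝓘(ℝ, E) x} {q : N} {a : ℝ → E} {s : Set ℝ}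
    (ha : ∀ t ∈ s, a t ∈ (extChartAt 𝓘(ℝ, E) q).target ∧ HasDerivAt a (chartField q X (a t)) t) :
    IsMIntegralCurveOn (fun t => (extChartAt 𝓘(ℝ, E) q).symm (a t)) X s := by
  intro t ht
  obtain ⟨h1, h2⟩ := ha t ht
  have h3 := (mdifferentiableAt_extChartAt_symm' h1).hasMFDerivAt.comp t
    h2.hasFDerivAt.hasMFDerivAt
  refine (h3.congr_mfderiv ?_).hasMFDerivWithinAt
  refine ContinuousLinearMap.ext_ring ?_
  change mfderiv 𝓘(ℝ, E) 𝓘(ℝ, E) (extChartAt 𝓘(ℝ, E) q).symm (a t)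
    ((1 : ℝ) • chartField (E := E) q X (a t)) = (1 : ℝ) • X _
  rw [one_smul, one_smul]
  exact mfderiv_extChartAt_symm_chartField X h1

theorem chartForm_mfderiv_extChartAt [IsManifold 𝓘(ℝ, E) ∞ N]
    (θ : (x : N) → TangentSpace 𝓘(ℝ, E) x →L[ℝ] ℝ) {q u : N}
    (hu : u ∈ (extChartAt 𝓘(ℝ, E) q).source) (w : TangentSpace 𝓘(ℝ, E) u) :
    chartForm q θ (extChartAt 𝓘(ℝ, E) q u) (mfderiv 𝓘(ℝ, E) 𝓘(ℝ, E) (extChartAt 𝓘(ℝ, E) q) u w) =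
      θ u w := by
  have key : ∀ v, v = u → ∀ w' : E, w' = w → (θ v : E →L[ℝ] ℝ) w' = θ u w := by
    rintro _ rfl _ rfl; rfl
  exact key _ ((extChartAt 𝓘(ℝ, E) q).left_inv hu) _
    (mfderiv_extChartAt_symm_mfderiv_extChartAt hu w)

theorem mfderiv_extChartAt_symm_combination [IsManifold 𝓘(ℝ, E) ∞ N]
    (X Y Z : (x : N) → TangentSpace 𝓘(ℝ, E) x) {q : N} {x : E}
    (hx : x ∈ (extChartAt 𝓘(ℝ, E) q).target) (a b c k s : ℝ) :
    mfderiv 𝓘(ℝ, E) 𝓘(ℝ, E) (extChartAt 𝓘(ℝ, E) q).symm x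
      (a • chartField (E := E) q X x +
        b • (k • chartField (E := E) q Y x - s • chartField (E := E) q Z x) +
        c • (s • chartField (E := E) q Y x + k • chartField (E := E) q Z x) : E) =
      a • X ((extChartAt 𝓘(ℝ, E) q).symm x) +
      b • (k • Y ((extChartAt 𝓘(ℝ, E) q).symm x) - s • Z ((extChartAt 𝓘(ℝ, E) q).symm x)) +
      c • (s • Y ((extChartAt 𝓘(ℝ, E) q).symm x) + k • Z ((extChartAt 𝓘(ℝ, E) q).symm x)) := by
  rw [← mfderiv_extChartAt_symm_chartField X hx, ← mfderiv_extChartAt_symm_chartField Y hx,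
    ← mfderiv_extChartAt_symm_chartField Z hx]
  have lin : ∀ (L : E →L[ℝ] E) (x y z : E), L (a • x + b • (k • y - s • z) + c • (s • y + k • z)) =
      a • L x + b • (k • L y - s • L z) + c • (s • L y + k • L z) := by
    intros
    simp only [map_add, map_smul, map_sub]
  exact lin (mfderiv 𝓘(ℝ, E) 𝓘(ℝ, E) (extChartAt 𝓘(ℝ, E) q).symm x) _ _ _

/-- Brackets are natural, so the rotation formula holds for the local flow in a chart, and
uniqueness of integral curves identifies that flow with `Φ`. The time `ε` is uniform for base points
near `q`, as continuation in time requires. -/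
theorem exists_hasMFDerivAt_flow_near [CompleteSpace E] [IsManifold 𝓘(ℝ, E) ∞ N] [T2Space N]
    {X Y Z : (x : N) → TangentSpace 𝓘(ℝ, E) x}
    (hX : ContMDiff 𝓘(ℝ, E) 𝓘(ℝ, E).tangent ∞ (fun x => (⟨x, X x⟩ : TangentBundle 𝓘(ℝ, E) N)))
    (hY : ContMDiff 𝓘(ℝ, E) 𝓘(ℝ, E).tangent ∞ (fun x => (⟨x, Y x⟩ : TangentBundle 𝓘(ℝ, E) N)))
    (hZ : ContMDiff 𝓘(ℝ, E) 𝓘(ℝ, E).tangent ∞ (fun x => (⟨x, Z x⟩ : TangentBundle 𝓘(ℝ, E) N)))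
    (hXY : mlieBracket 𝓘(ℝ, E) X Y = Z) (hXZ : mlieBracket 𝓘(ℝ, E) X Z = -Y)
    {θ₁ θ₂ θ₃ : (x : N) → TangentSpace 𝓘(ℝ, E) x →L[ℝ] ℝ}
    (hθ : ∀ u w, θ₁ u w • X u + θ₂ u w • Y u + θ₃ u w • Z u = w)
    {Φ : ℝ → N → N} (hΦ0 : ∀ u, Φ 0 u = u) (hΦ : ∀ u, IsMIntegralCurve (fun t => Φ t u) X) (q : N) :
    ∃ ε > (0 : ℝ), ∀ᶠ u in 𝓝 q, ∀ t ∈ Ioo (-ε) ε, HasMFDerivAt 𝓘(ℝ, E) 𝓘(ℝ, E) (Φ t) u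
      (frameRotation X Y Z θ₁ θ₂ θ₃ t u (Φ t u)) := by
  set φ : PartialEquiv N E := extChartAt 𝓘(ℝ, E) q with hφ
  obtain ⟨ε, hε, α, hα, hder⟩ := exists_local_flow_rotation (isOpen_extChartAt_target (I := 𝓘(ℝ, E)) q)
    ((contDiffOn_chartField q hX).of_le (by norm_cast))
    ((contDiffOn_chartField q hY).differentiableOn (by simp))
    ((contDiffOn_chartField q hZ).differentiableOn (by simp))
    (fun x hx => by rw [lieBracket_chartField hX hY hx, hXY])
    (fun x hx => by
      rw [lieBracket_chartField hX hZ hx, hXZ, chartField, mpullback_neg]; rfl)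
    (mem_extChartAt_target (I := 𝓘(ℝ, E)) q)
  refine ⟨ε, hε, ?_⟩
  have hcont : Filter.Tendsto φ (𝓝 q) (𝓝 (φ q)) := continuousAt_extChartAt (I := 𝓘(ℝ, E)) q
  have hflow : ∀ᶠ u in 𝓝 q, ∀ t ∈ Ioo (-ε) ε, φ.symm (α (φ u) t) = Φ t u := by
    filter_upwards [hcont.eventually hα, extChartAt_source_mem_nhds (I := 𝓘(ℝ, E)) q] with u hu hus t ht
    have h0 : (0 : ℝ) ∈ Ioo (-ε) ε := ⟨by linarith, hε⟩
    refine isMIntegralCurveOn_Ioo_eqOn_of_contMDiff_boundaryless h0 (hX.of_le (by norm_cast))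
      (isMIntegralCurveOn_extChartAt_symm_comp hu.2) ((hΦ u).isMIntegralCurveOn _) ?_ ht
    rw [hu.1, hΦ0, φ.left_inv hus]
  filter_upwards [hcont.eventually hder, hflow.eventually_nhds, hcont.eventually hα,
    extChartAt_source_mem_nhds (I := 𝓘(ℝ, E)) q] with u hu hfl hαu hus t ht
  have : IsManifold 𝓘(ℝ, E) 1 N := .of_le (n := ∞) (by norm_cast)
  have hut : φ u ∈ φ.target := φ.map_source hus
  have hd := hu t ht (chartForm q θ₁ (φ u)) (chartForm q θ₂ (φ u)) (chartForm q θ₃ (φ u)) (by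
    intro w
    have e := hθ (φ.symm (φ u)) (mfderiv 𝓘(ℝ, E) 𝓘(ℝ, E) φ.symm (φ u) w)
    have e' := congrArg (mfderiv 𝓘(ℝ, E) 𝓘(ℝ, E) φ (φ.symm (φ u))) e
    rw [mfderiv_extChartAt_mfderiv_extChartAt_symm hut] at e'
    have s' : φ.symm (φ u) ∈ φ.source := φ.map_target hut
    simp only [map_add, map_smul] at e'
    rw [mfderiv_extChartAt_eq_chartField X s', mfderiv_extChartAt_eq_chartField Y s',
      mfderiv_extChartAt_eq_chartField Z s', ← hφ, φ.right_inv hut] at e'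
    exact e')
  have hφd : HasMFDerivAt 𝓘(ℝ, E) 𝓘(ℝ, E) φ u (mfderiv 𝓘(ℝ, E) 𝓘(ℝ, E) φ u) :=
    (mdifferentiableAt_extChartAt (by simpa using hus)).hasMFDerivAt
  have hat : α (φ u) t ∈ φ.target := (hαu.2 t ht).1
  have hc := ((mdifferentiableAt_extChartAt_symm' hat).hasMFDerivAt.comp (φ u)
    hd.hasMFDerivAt).comp u hφd
  have hc' := hc.congr_of_eventuallyEq (f₁ := Φ t) (by
    filter_upwards [hfl] with v hv
    exact (hv t ht).symm)
  -- The tangent spaces at `Φ t u` and at the equal point `φ.symm (α (φ u) t)` are different types;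
  -- generalising the point lets the equality be substituted.
  have key : ∀ v, v = φ.symm (α (φ u) t) → ∀ w : TangentSpace 𝓘(ℝ, E) u,
      (mfderiv 𝓘(ℝ, E) 𝓘(ℝ, E) φ.symm (α (φ u) t) (
        chartForm q θ₁ (φ u) (mfderiv 𝓘(ℝ, E) 𝓘(ℝ, E) φ u w) • chartField q X (α (φ u) t) +
        chartForm q θ₂ (φ u) (mfderiv 𝓘(ℝ, E) 𝓘(ℝ, E) φ u w) •
          (Real.cos t • chartField q Y (α (φ u) t) - Real.sin t • chartField q Z (α (φ u) t)) +
        chartForm q θ₃ (φ u) (mfderiv 𝓘(ℝ, E) 𝓘(ℝ, E) φ u w) •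
          (Real.sin t • chartField q Y (α (φ u) t) +
            Real.cos t • chartField q Z (α (φ u) t)) : E) : E) =
      frameRotation X Y Z θ₁ θ₂ θ₃ t u v w := by
    rintro _ rfl w
    rw [frameRotation_apply, ← chartForm_mfderiv_extChartAt θ₁ hus,
      ← chartForm_mfderiv_extChartAt θ₂ hus, ← chartForm_mfderiv_extChartAt θ₃ hus]
    exact mfderiv_extChartAt_symm_combination X Y Z hat ..
  exact hc'.congr_mfderiv (ContinuousLinearMap.ext (key _ (hfl.self_of_nhds t ht).symm))

/-- A smooth frame `(X, Y, Z)` with dual coframe `(θ₁, θ₂, θ₃)` such that `[X, Y] = Z` and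
`[X, Z] = -Y`. -/
structure IsRotationFrame [IsManifold 𝓘(ℝ, E) ∞ N] (X Y Z : (x : N) → TangentSpace 𝓘(ℝ, E) x)
    (θ₁ θ₂ θ₃ : (x : N) → TangentSpace 𝓘(ℝ, E) x →L[ℝ] ℝ) : Prop where
  smooth_X : ContMDiff 𝓘(ℝ, E) 𝓘(ℝ, E).tangent ∞ (fun x => (⟨x, X x⟩ : TangentBundle 𝓘(ℝ, E) N))
  smooth_Y : ContMDiff 𝓘(ℝ, E) 𝓘(ℝ, E).tangent ∞ (fun x => (⟨x, Y x⟩ : TangentBundle 𝓘(ℝ, E) N))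
  smooth_Z : ContMDiff 𝓘(ℝ, E) 𝓘(ℝ, E).tangent ∞ (fun x => (⟨x, Z x⟩ : TangentBundle 𝓘(ℝ, E) N))
  smooth_θ₁ : ContMDiff 𝓘(ℝ, E).tangent 𝓘(ℝ, ℝ) ∞
    (fun v : TangentBundle 𝓘(ℝ, E) N => θ₁ v.proj v.snd)
  smooth_θ₂ : ContMDiff 𝓘(ℝ, E).tangent 𝓘(ℝ, ℝ) ∞
    (fun v : TangentBundle 𝓘(ℝ, E) N => θ₂ v.proj v.snd)
  smooth_θ₃ : ContMDiff 𝓘(ℝ, E).tangent 𝓘(ℝ, ℝ) ∞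
    (fun v : TangentBundle 𝓘(ℝ, E) N => θ₃ v.proj v.snd)
  bracket_XY : mlieBracket 𝓘(ℝ, E) X Y = Z
  bracket_XZ : mlieBracket 𝓘(ℝ, E) X Z = -Y
  sum_eq : ∀ u w, θ₁ u w • X u + θ₂ u w • Y u + θ₃ u w • Z u = w
  θ₁_eq : ∀ u, θ₁ u (X u) = 1 ∧ θ₁ u (Y u) = 0 ∧ θ₁ u (Z u) = 0
  θ₂_eq : ∀ u, θ₂ u (X u) = 0 ∧ θ₂ u (Y u) = 1 ∧ θ₂ u (Z u) = 0
  θ₃_eq : ∀ u, θ₃ u (X u) = 0 ∧ θ₃ u (Y u) = 0 ∧ θ₃ u (Z u) = 1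

namespace IsRotationFrame

variable [IsManifold 𝓘(ℝ, E) ∞ N] {X Y Z : (x : N) → TangentSpace 𝓘(ℝ, E) x}
  {θ₁ θ₂ θ₃ : (x : N) → TangentSpace 𝓘(ℝ, E) x →L[ℝ] ℝ}

theorem frameRotation_θ₁ (h : IsRotationFrame X Y Z θ₁ θ₂ θ₃) (t : ℝ) (u v : N)
    (w : TangentSpace 𝓘(ℝ, E) u) : θ₁ v (frameRotation X Y Z θ₁ θ₂ θ₃ t u v w) = θ₁ u w := by
  simp [frameRotation_apply, h.θ₁_eq v]

theorem frameRotation_θ₂ (h : IsRotationFrame X Y Z θ₁ θ₂ θ₃) (t : ℝ) (u v : N)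
    (w : TangentSpace 𝓘(ℝ, E) u) : θ₂ v (frameRotation X Y Z θ₁ θ₂ θ₃ t u v w) =
      Real.cos t * θ₂ u w + Real.sin t * θ₃ u w := by
  simp [frameRotation_apply, h.θ₂_eq v, mul_comm]

theorem frameRotation_θ₃ (h : IsRotationFrame X Y Z θ₁ θ₂ θ₃) (t : ℝ) (u v : N)
    (w : TangentSpace 𝓘(ℝ, E) u) : θ₃ v (frameRotation X Y Z θ₁ θ₂ θ₃ t u v w) =
      -(Real.sin t * θ₂ u w) + Real.cos t * θ₃ u w := by
  simp [frameRotation_apply, h.θ₃_eq v, mul_comm]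

theorem frameRotation_X (h : IsRotationFrame X Y Z θ₁ θ₂ θ₃) (t : ℝ) (u v : N) :
    frameRotation X Y Z θ₁ θ₂ θ₃ t u v (X u) = X v := by
  simp [frameRotation_apply, h.θ₁_eq u, h.θ₂_eq u, h.θ₃_eq u]

theorem frameRotation_comp (h : IsRotationFrame X Y Z θ₁ θ₂ θ₃) (s t : ℝ) (u v q : N) :
    (frameRotation X Y Z θ₁ θ₂ θ₃ s v q).comp (frameRotation X Y Z θ₁ θ₂ θ₃ t u v) =
      frameRotation X Y Z θ₁ θ₂ θ₃ (s + t) u q := by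
  ext w
  rw [ContinuousLinearMap.comp_apply, frameRotation_apply, h.frameRotation_θ₁,
    h.frameRotation_θ₂, h.frameRotation_θ₃, frameRotation_apply, Real.cos_add, Real.sin_add]
  module

variable [T2Space N] {Φ : ℝ → N → N}

theorem flow_add (h : IsRotationFrame X Y Z θ₁ θ₂ θ₃) (hΦ0 : ∀ u, Φ 0 u = u)
    (hΦ : ∀ u, IsMIntegralCurve (fun t => Φ t u) X) (s t : ℝ) (u : N) :
    Φ (s + t) u = Φ s (Φ t u) := by
  have := isMIntegralCurve_Ioo_eq_of_contMDiff_boundaryless (t₀ := 0)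
    (h.smooth_X.of_le (by norm_cast)) ((hΦ u).comp_add t) (hΦ (Φ t u)) (by simp [hΦ0])
  exact congrFun this s

/-- Continuation in time along one orbit: the short-time formula holds near `Φ t₀ u`, and rotation
angles add under composition, so validity passes between any two times close to `t₀`. Being locally
constant on the connected line and true at 0, it holds always. -/
theorem hasMFDerivAt_flow [CompleteSpace E] (h : IsRotationFrame X Y Z θ₁ θ₂ θ₃) (hΦ0 : ∀ u, Φ 0 u = u)
    (hΦ : ∀ u, IsMIntegralCurve (fun t => Φ t u) X) (t : ℝ) (u : N) :
    HasMFDerivAt 𝓘(ℝ, E) 𝓘(ℝ, E) (Φ t) u (frameRotation X Y Z θ₁ θ₂ θ₃ t u (Φ t u)) := by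
  let P : ℝ → Prop := fun t =>
    HasMFDerivAt 𝓘(ℝ, E) 𝓘(ℝ, E) (Φ t) u (frameRotation X Y Z θ₁ θ₂ θ₃ t u (Φ t u))
  have near : ∀ t₀, ∃ U ∈ 𝓝 t₀, ∀ t ∈ U, ∀ t' ∈ U, P t → P t' := by
    intro t₀
    obtain ⟨ε, hε, hn⟩ := exists_hasMFDerivAt_flow_near h.smooth_X h.smooth_Y h.smooth_Z
      h.bracket_XY h.bracket_XZ h.sum_eq hΦ0 hΦ (Φ t₀ u)
    have hc := (hΦ u).continuous.continuousAt.eventually hn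
    -- With radius `ε / 2`, any two times in the ball differ by less than `ε`.
    refine ⟨_, Filter.inter_mem hc (Metric.ball_mem_nhds t₀ (half_pos hε)), ?_⟩
    rintro t ⟨ht, hb⟩ t' ⟨-, hb'⟩ hP
    rw [Metric.mem_ball, Real.dist_eq, abs_lt] at hb hb'
    have hd := (ht (t' - t) ⟨by linarith, by linarith⟩).comp u hP
    rw [h.frameRotation_comp] at hd
    have e : ∀ v, Φ t' v = Φ (t' - t) (Φ t v) := fun v => by
      rw [← h.flow_add hΦ0 hΦ, sub_add_cancel]
    rw [← e, sub_add_cancel] at hd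
    exact hd.congr_of_eventuallyEq (Filter.Eventually.of_forall e)
  have hlc : IsLocallyConstant P := by
    rw [IsLocallyConstant.iff_eventually_eq]
    intro t₀
    obtain ⟨U, hU, hUP⟩ := near t₀
    filter_upwards [hU] with t ht
    exact propext ⟨hUP t ht t₀ (mem_of_mem_nhds hU), hUP t₀ (mem_of_mem_nhds hU) t ht⟩
  have h0 : P 0 := by
    have hid : HasMFDerivAt 𝓘(ℝ, E) 𝓘(ℝ, E) (id : N → N) u
        (frameRotation X Y Z θ₁ θ₂ θ₃ 0 u u) :=
      (hasMFDerivAt_id u).congr_mfderiv (ContinuousLinearMap.ext fun w => by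
        rw [frameRotation_apply]
        simpa using (h.sum_eq u w).symm)
    have key : ∀ f : N → N, f = id → HasMFDerivAt 𝓘(ℝ, E) 𝓘(ℝ, E) f u
        (frameRotation X Y Z θ₁ θ₂ θ₃ 0 u (f u)) := by
      rintro _ rfl
      exact hid
    exact key (Φ 0) (funext hΦ0)
  have := hlc.apply_eq_of_isPreconnected isPreconnected_univ (mem_univ t) (mem_univ 0)
  exact this.mpr h0

end IsRotationFrame

/-- A map whose differential is a sum `∑ i, θ i ⊗ Z i` of smooth `1`-forms on the source with values
in smooth vector fields along the target is smooth. -/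
theorem contMDiffOn_of_hasMFDerivAt_sum [IsManifold 𝓘(ℝ, E) ∞ N] [FiniteDimensional ℝ E]
    {E' : Type*} [NormedAddCommGroup E'] [NormedSpace ℝ E'] [CompleteSpace E']
    {N' : Type*} [TopologicalSpace N'] [ChartedSpace E' N'] [IsManifold 𝓘(ℝ, E') ∞ N']
    {ι : Type*} [Fintype ι]
    {θ : ι → (x : N) → TangentSpace 𝓘(ℝ, E) x →L[ℝ] ℝ}
    {Z : ι → (x : N') → TangentSpace 𝓘(ℝ, E') x}
    (hθ : ∀ i, ContMDiff 𝓘(ℝ, E).tangent 𝓘(ℝ, ℝ) ∞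
      (fun v : TangentBundle 𝓘(ℝ, E) N => θ i v.proj v.snd))
    {O : Set N'} (hO : IsOpen O) (hZ : ∀ i, ContMDiffOn 𝓘(ℝ, E') 𝓘(ℝ, E').tangent ∞
      (fun x => (⟨x, Z i x⟩ : TangentBundle 𝓘(ℝ, E') N')) O)
    {g : N → N'} {s : Set N} (hs : IsOpen s) (hgO : MapsTo g s O)
    (hg : ∀ u ∈ s, HasMFDerivAt 𝓘(ℝ, E) 𝓘(ℝ, E') g u (∑ i, (θ i u).smulRight (Z i (g u)))) :
    ContMDiffOn 𝓘(ℝ, E) 𝓘(ℝ, E') ∞ g s := by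
  have : IsManifold 𝓘(ℝ, E) 1 N := .of_le (n := ∞) (by norm_cast)
  have : IsManifold 𝓘(ℝ, E') 1 N' := .of_le (n := ∞) (by norm_cast)
  have hcont : ContinuousOn g s := fun u hu => (hg u hu).continuousAt.continuousWithinAt
  rw [contMDiffOn_iff]
  refine ⟨hcont, fun q q' => ?_⟩
  set φ : PartialEquiv N E := extChartAt 𝓘(ℝ, E) q with hφ
  set ψ : PartialEquiv N' E' := extChartAt 𝓘(ℝ, E') q' with hψ
  set W : Set E := φ.target ∩ φ.symm ⁻¹' (s ∩ g ⁻¹' ψ.source) with hW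
  have hWo : IsOpen W := by
    have h1 : IsOpen (s ∩ g ⁻¹' ψ.source) :=
      hcont.isOpen_inter_preimage hs (isOpen_extChartAt_source q')
    exact (continuousOn_extChartAt_symm q).isOpen_inter_preimage (isOpen_extChartAt_target q) h1
  refine contDiffOn_of_hasFDerivAt_sum (W' := ψ.target ∩ ψ.symm ⁻¹' O) hWo
    (fun x hx => ⟨ψ.map_source hx.2.2, by
      simpa only [mem_preimage, Function.comp_apply, ψ.left_inv hx.2.2] using hgO hx.2.1⟩) (θ := fun i => chartForm q (θ i))
    (Z := fun i => chartField q' (Z i))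
    (fun i => (contDiffOn_chartForm q (hθ i)).mono fun x hx => hx.1)
    (fun i => contDiffOn_chartField_of_contMDiffOn q' hO (hZ i)) fun x hx => ?_
  have hd := (((mdifferentiableAt_extChartAt (I := 𝓘(ℝ, E')) (x := q')
    (by rw [← extChartAt_source 𝓘(ℝ, E')]; exact hx.2.2)).hasMFDerivAt).comp (φ.symm x) (hg _ hx.2.1)).comp x (mdifferentiableAt_extChartAt_symm' hx.1).hasMFDerivAt
  have key : ∀ (L : E' →L[ℝ] E') (a : ι → E →L[ℝ] ℝ) (z : ι → E') (v : E),
      L ((∑ i, (a i).smulRight (z i)) v) = ∑ i, a i v • L (z i) := by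
    intros
    simp
  refine hd.hasFDerivAt.congr_fderiv (ContinuousLinearMap.ext fun w => ?_)
  refine (key (mfderiv 𝓘(ℝ, E') 𝓘(ℝ, E') ψ (g (φ.symm x))) _ _ _).trans
    (Eq.trans ?_ (key (ContinuousLinearMap.id ℝ E') _ _ w).symm)
  exact Finset.sum_congr rfl fun i _ =>
    congrArg (_ • ·) (mfderiv_extChartAt_eq_chartField (Z i) hx.2.2)

end RotationFlow

/-! ### Smoothness of the frame dual to a coframing. -/

section DualFrame

variable {E : Type*} [NormedAddCommGroup E] [NormedSpace ℝ E] [FiniteDimensional ℝ E]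
  {N : Type*} [TopologicalSpace N] [ChartedSpace E N] [IsManifold 𝓘(ℝ, E) ∞ N]

/-- A vector field with constant components in a smooth coframing is smooth. -/
theorem contMDiff_of_coframing_const {θ₁ θ₂ θ₃ : (x : N) → TangentSpace 𝓘(ℝ, E) x →L[ℝ] ℝ}
    (h₁ : ContMDiff 𝓘(ℝ, E).tangent 𝓘(ℝ, ℝ) ∞ (fun v : TangentBundle 𝓘(ℝ, E) N => θ₁ v.proj v.snd))
    (h₂ : ContMDiff 𝓘(ℝ, E).tangent 𝓘(ℝ, ℝ) ∞ (fun v : TangentBundle 𝓘(ℝ, E) N => θ₂ v.proj v.snd))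
    (h₃ : ContMDiff 𝓘(ℝ, E).tangent 𝓘(ℝ, ℝ) ∞ (fun v : TangentBundle 𝓘(ℝ, E) N => θ₃ v.proj v.snd))
    (hbij : ∀ u, Function.Bijective (((θ₁ u).prod ((θ₂ u).prod (θ₃ u)) :
      TangentSpace 𝓘(ℝ, E) u →L[ℝ] ℝ × ℝ × ℝ)))
    {V : (x : N) → TangentSpace 𝓘(ℝ, E) x} {a : ℝ × ℝ × ℝ}
    (hV : ∀ u, ((θ₁ u).prod ((θ₂ u).prod (θ₃ u))) (V u) = a) :
    ContMDiff 𝓘(ℝ, E) 𝓘(ℝ, E).tangent ∞ (fun x => (⟨x, V x⟩ : TangentBundle 𝓘(ℝ, E) N)) := by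
  have : IsManifold 𝓘(ℝ, E) 1 N := .of_le (n := ∞) (by norm_cast)
  intro q
  set φ : PartialEquiv N E := extChartAt 𝓘(ℝ, E) q with hφ
  -- In coordinates the field is the inverse of the coframe matrix applied to `a`, and inversion is
  -- smooth.
  let A : E → E →L[ℝ] ℝ × ℝ × ℝ := fun x =>
    (chartForm q θ₁ x).prod ((chartForm q θ₂ x).prod (chartForm q θ₃ x))
  have hA : ContDiffOn ℝ ∞ A φ.target := by
    rw [contDiffOn_clm_apply]
    intro w
    exact ((contDiffOn_chartForm q h₁).clm_apply contDiffOn_const).prodMk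
      (((contDiffOn_chartForm q h₂).clm_apply contDiffOn_const).prodMk
      ((contDiffOn_chartForm q h₃).clm_apply contDiffOn_const))
  have hAbij : ∀ x ∈ φ.target, Function.Bijective (A x) := fun x hx => by
    obtain ⟨e, he⟩ := isInvertible_mfderiv_extChartAt_symm' hx
    have h := (hbij (φ.symm x)).comp e.bijective
    change Function.Bijective (fun w : TangentSpace 𝓘(ℝ, E) x =>
      ((θ₁ (φ.symm x)).prod ((θ₂ (φ.symm x)).prod (θ₃ (φ.symm x))))
        (mfderiv 𝓘(ℝ, E) 𝓘(ℝ, E) φ.symm x w))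
    rw [← he]
    exact h
  have hinv : ContDiffOn ℝ ∞ (fun x => (A x).inverse a) φ.target := by
    intro x hx
    let e : E ≃L[ℝ] ℝ × ℝ × ℝ := (LinearEquiv.ofBijective (A x).toLinearMap
      (hAbij x hx)).toContinuousLinearEquiv
    have hAx : A x = (e : E →L[ℝ] ℝ × ℝ × ℝ) := by ext1 w; rfl
    have h1 : ContDiffAt ℝ ∞ ContinuousLinearMap.inverse (A x) := by
      rw [hAx]; exact contDiffAt_map_inverse e
    exact (h1.comp_contDiffWithinAt x (hA x hx)).clm_apply contDiffWithinAt_const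
  have h1 := (contMDiffOn_extChartAt_symm (I := 𝓘(ℝ, E)) (n := ∞) q).contMDiffOn_tangentMapWithin
    (m := ∞) (by simp) (isOpen_extChartAt_target q).uniqueMDiffOn
  have h2 := contMDiffOn_vectorSpace_iff_contDiffOn.2 hinv
  have h3 := (h1.comp h2 fun x hx => hx).comp
    (contMDiffOn_extChartAt (I := 𝓘(ℝ, E)) (n := ∞) (x := q))
    (fun u hu => φ.map_source (by rwa [hφ, extChartAt_source]))
  refine (h3.congr fun u hu => ?_).contMDiffAt (chart_source_mem_nhds E q)
  have hus : u ∈ φ.source := by rwa [hφ, extChartAt_source]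
  have hut : φ u ∈ φ.target := φ.map_source hus
  have e1 : (A (φ u)).inverse a = mfderiv 𝓘(ℝ, E) 𝓘(ℝ, E) φ u (V u) := by
    let e : E ≃L[ℝ] ℝ × ℝ × ℝ := (LinearEquiv.ofBijective (A (φ u)).toLinearMap
      (hAbij _ hut)).toContinuousLinearEquiv
    have hAx : A (φ u) = (e : E →L[ℝ] ℝ × ℝ × ℝ) := by ext1 w; rfl
    rw [hAx, ContinuousLinearMap.inverse_equiv]
    refine e.symm_apply_eq.2 ?_
    change _ = A (φ u) _
    rw [← hV u]
    exact (Prod.ext (chartForm_mfderiv_extChartAt θ₁ hus _) (Prod.ext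
      (chartForm_mfderiv_extChartAt θ₂ hus _) (chartForm_mfderiv_extChartAt θ₃ hus _))).symm
  simp only [Function.comp_def, tangentMapWithin]
  rw [mfderivWithin_of_isOpen (isOpen_extChartAt_target q) hut, e1]
  have key : ∀ v, v = u → ∀ w' : E, w' = V u →
      (⟨u, V u⟩ : TangentBundle 𝓘(ℝ, E) N) = ⟨v, w'⟩ := by rintro _ rfl _ rfl; rfl
  exact key _ (φ.left_inv hus) _ (mfderiv_extChartAt_symm_mfderiv_extChartAt hus _)

end DualFrame

variable {M : Type*} [TopologicalSpace M] [ChartedSpace (EuclideanSpace ℝ (Fin 2)) M]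
  [IsManifold (𝓡 2) ∞ M]

/-! ### From Cartan's equations with K = 1 to a rotation frame. -/

namespace FinslerStructure.Coframing

variable {F : FinslerStructure M} (η : F.Coframing)

/-- The vector field with constant components `a` in the coframing. -/
def frame (a : ℝ × ℝ × ℝ) : VField (n := 3) F.carrier := fun u =>
  (Equiv.ofBijective _ (η.bijective u)).symm a

theorem coframe_frame (a : ℝ × ℝ × ℝ) (u : F.carrier) :
    ((η.ω₁ u).prod ((η.ω₂ u).prod (η.ω₃ u))) (η.frame a u) = a :=
  (Equiv.ofBijective _ (η.bijective u)).apply_symm_apply a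

theorem ω₁_frame (a : ℝ × ℝ × ℝ) (u : F.carrier) : η.ω₁ u (η.frame a u) = a.1 :=
  congrArg Prod.fst (η.coframe_frame a u)

theorem ω₂_frame (a : ℝ × ℝ × ℝ) (u : F.carrier) : η.ω₂ u (η.frame a u) = a.2.1 :=
  congrArg (fun p => p.2.1) (η.coframe_frame a u)

theorem ω₃_frame (a : ℝ × ℝ × ℝ) (u : F.carrier) : η.ω₃ u (η.frame a u) = a.2.2 :=
  congrArg (fun p => p.2.2) (η.coframe_frame a u)

theorem ext_coframe {u : F.carrier} {v w : TangentSpace (𝓡 3) u} (h₁ : η.ω₁ u v = η.ω₁ u w)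
    (h₂ : η.ω₂ u v = η.ω₂ u w) (h₃ : η.ω₃ u v = η.ω₃ u w) : v = w :=
  (η.bijective u).1 (Prod.ext h₁ (Prod.ext h₂ h₃))

theorem isSmooth_frame (a : ℝ × ℝ × ℝ) : (η.frame a).IsSmooth :=
  contMDiff_of_coframing_const η.smooth₁ η.smooth₂ η.smooth₃ η.bijective (η.coframe_frame a)

/-- With constant pairings only the bracket term of the exterior derivative survives; this turns
structure equations into bracket relations. -/
theorem d_eq_neg_of_const {θ : OneForm (n := 3) F.carrier} {V W : VField (n := 3) F.carrier}
    {a b : ℝ} (hV : ∀ u, θ u (V u) = a) (hW : ∀ u, θ u (W u) = b) (u : F.carrier) :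
    θ.d V W u = -θ u (mlieBracket (𝓡 3) V W u) := by
  have eV : (fun q => θ q (V q)) = fun _ => a := funext hV
  have eW : (fun q => θ q (W q)) = fun _ => b := funext hW
  rw [OneForm.d, VField.apply, VField.apply, eV, eW, mfderiv_const, mfderiv_const]
  change (0 : ℝ) - 0 - _ = _
  rw [sub_zero, zero_sub]

theorem isRotationFrame (hK : η.HasCurvature (fun _ => 1)) :
    IsRotationFrame η.X₁ (η.frame (0, 1, 0)) (η.frame (0, 0, 1)) η.ω₁ η.ω₂ η.ω₃ := by
  obtain ⟨I, J, h⟩ := hK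
  have hb : ∀ a b : ℝ × ℝ × ℝ, ∀ u,
      η.ω₁ u (mlieBracket (𝓡 3) (η.frame a) (η.frame b) u) = a.2.1 * b.2.2 - b.2.1 * a.2.2 ∧
      η.ω₂ u (mlieBracket (𝓡 3) (η.frame a) (η.frame b) u) =
        a.2.2 * (b.1 - I u * b.2.1) - b.2.2 * (a.1 - I u * a.2.1) ∧
      η.ω₃ u (mlieBracket (𝓡 3) (η.frame a) (η.frame b) u) =
        (a.1 - J u * a.2.2) * b.2.1 - (b.1 - J u * b.2.2) * a.2.1 := by
    intro a b u
    have e1 := h.dω₁ _ _ (η.isSmooth_frame a) (η.isSmooth_frame b) u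
    have e2 := h.dω₂ _ _ (η.isSmooth_frame a) (η.isSmooth_frame b) u
    have e3 := h.dω₃ _ _ (η.isSmooth_frame a) (η.isSmooth_frame b) u
    rw [d_eq_neg_of_const (η.ω₁_frame a) (η.ω₁_frame b)] at e1
    rw [d_eq_neg_of_const (η.ω₂_frame a) (η.ω₂_frame b)] at e2
    rw [d_eq_neg_of_const (η.ω₃_frame a) (η.ω₃_frame b)] at e3
    simp only [OneForm.wedge, sub_apply, smul_apply, smul_eq_mul, ω₁_frame, ω₂_frame,
      ω₃_frame] at e1 e2 e3
    refine ⟨?_, ?_, ?_⟩ <;> linarith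
  exact
  { smooth_X := η.isSmooth_frame _
    smooth_Y := η.isSmooth_frame _
    smooth_Z := η.isSmooth_frame _
    smooth_θ₁ := η.smooth₁
    smooth_θ₂ := η.smooth₂
    smooth_θ₃ := η.smooth₃
    bracket_XY := by
      funext u
      obtain ⟨e1, e2, e3⟩ := hb (1, 0, 0) (0, 1, 0) u
      apply η.ext_coframe
      · rw [ω₁_frame]; exact e1.trans (by simp)
      · rw [ω₂_frame]; exact e2.trans (by simp)
      · rw [ω₃_frame]; exact e3.trans (by simp)
    bracket_XZ := by
      funext u
      obtain ⟨e1, e2, e3⟩ := hb (1, 0, 0) (0, 0, 1) u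
      apply η.ext_coframe
      · rw [Pi.neg_apply, map_neg, ω₁_frame]; exact e1.trans (by simp)
      · rw [Pi.neg_apply, map_neg, ω₂_frame]; exact e2.trans (by simp)
      · rw [Pi.neg_apply, map_neg, ω₃_frame]; exact e3.trans (by simp)
    sum_eq := fun u w => by
      change η.ω₁ u w • η.frame (1, 0, 0) u + η.ω₂ u w • η.frame (0, 1, 0) u +
        η.ω₃ u w • η.frame (0, 0, 1) u = w
      apply η.ext_coframe <;> simp [ω₁_frame, ω₂_frame, ω₃_frame]
    θ₁_eq := fun u => ⟨η.ω₁_frame _ u, η.ω₁_frame _ u, η.ω₁_frame _ u⟩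
    θ₂_eq := fun u => ⟨η.ω₂_frame _ u, η.ω₂_frame _ u, η.ω₂_frame _ u⟩
    θ₃_eq := fun u => ⟨η.ω₃_frame _ u, η.ω₃_frame _ u, η.ω₃_frame _ u⟩ }

end FinslerStructure.Coframing

/-! ### Submersions: local sections and descent along fibres. -/

section Submersion

variable {E B : Type*} [NormedAddCommGroup E] [NormedSpace ℝ E] [NormedAddCommGroup B]
  [NormedSpace ℝ B] {N Q : Type*} [TopologicalSpace N] [ChartedSpace E N]
  [TopologicalSpace Q] [ChartedSpace B Q]
  {G : Type*} [NormedAddCommGroup G] [NormedSpace ℝ G]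

theorem contMDiffOn_extend_self {φ : OpenPartialHomeomorph N E} [IsManifold 𝓘(ℝ, E) ∞ N]
    (hφ : φ ∈ IsManifold.maximalAtlas 𝓘(ℝ, E) ∞ N) :
    ContMDiffOn 𝓘(ℝ, E) 𝓘(ℝ, E) ∞ (φ.extend 𝓘(ℝ, E)).symm (φ.extend 𝓘(ℝ, E)).target := by
  convert contMDiffOn_extend_symm hφ using 1
  simp

/-- A submersion has smooth local sections through every point. -/
theorem exists_local_section [IsManifold 𝓘(ℝ, E) ∞ N] [IsManifold 𝓘(ℝ, B) ∞ Q] {f : N → Q} {u : N}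
    (h : Manifold.IsSubmersionAtOfComplement G 𝓘(ℝ, E) 𝓘(ℝ, B) ∞ f u) :
    ∃ (O : Set Q) (σ : Q → N), IsOpen O ∧ f u ∈ O ∧ ContMDiffOn 𝓘(ℝ, B) 𝓘(ℝ, E) ∞ σ O ∧
      σ (f u) = u ∧ ∀ x ∈ O, f (σ x) = x := by
  set φ := h.domChart.extend 𝓘(ℝ, E) with hφ
  set ψ := h.codChart.extend 𝓘(ℝ, B) with hψ
  have hw := h.writtenInCharts
  rw [← hφ, ← hψ] at hw
  have huφ : u ∈ φ.source := by rw [hφ, OpenPartialHomeomorph.extend_source]; exact h.mem_domChart_source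
  have hfψ : f u ∈ ψ.source := by
    rw [hψ, OpenPartialHomeomorph.extend_source]; exact h.mem_codChart_source
  have hmaps : ∀ v ∈ φ.source, f v ∈ ψ.source := by
    rw [hφ, hψ, OpenPartialHomeomorph.extend_source, OpenPartialHomeomorph.extend_source]
    exact h.mapsto_domChart_source_codChart_source
  have hψo : IsOpen ψ.source := h.codChart.isOpen_extend_source
  have hψs : ContMDiffOn 𝓘(ℝ, B) 𝓘(ℝ, B) ∞ ψ ψ.source := by
    rw [hψ, OpenPartialHomeomorph.extend_source]
    exact h.codChart.contMDiffOn_extend h.codChart_mem_maximalAtlas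
  have hφt : IsOpen φ.target := by
    rw [hφ]; simpa using h.domChart.open_target
  -- In adapted coordinates the section freezes the fibre coordinate at its value at `u`.
  set lift : Q → E := fun x => h.equiv.symm (ψ x, (h.equiv (φ u)).2)
  have hlift : ContMDiffOn 𝓘(ℝ, B) 𝓘(ℝ, E) ∞ lift ψ.source := by
    have : ContDiff ℝ ∞ (fun y : B => h.equiv.symm (y, (h.equiv (φ u)).2)) := by fun_prop
    exact this.contMDiff.comp_contMDiffOn hψs
  have hfu : ψ (f u) = (h.equiv (φ u)).1 := by
    have := hw (φ.map_source huφ)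
    simpa only [Function.comp_apply, φ.left_inv huφ] using this
  have hlu : lift (f u) = φ u := by
    simp only [lift, hfu, Prod.mk.eta, ContinuousLinearEquiv.symm_apply_apply]
  refine ⟨ψ.source ∩ lift ⁻¹' φ.target, fun x => φ.symm (lift x),
    hlift.continuousOn.isOpen_inter_preimage hψo hφt, ⟨hfψ, ?_⟩, ?_, ?_, ?_⟩
  · rw [mem_preimage, hlu]; exact φ.map_source huφ
  · exact (contMDiffOn_extend_self h.domChart_mem_maximalAtlas).comp
      (hlift.mono inter_subset_left) (fun x hx => hx.2)
  · change φ.symm (lift (f u)) = u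
    rw [hlu, φ.left_inv huφ]
  · rintro x ⟨hx, hx'⟩
    refine ψ.injOn (hmaps _ (φ.map_target hx')) hx ?_
    have := hw hx'
    simpa [lift] using this

/-- A map whose differential vanishes on the kernel of the differential of a submersion is locally
constant along the fibres. -/
theorem exists_nhds_const_on_fibers [IsManifold 𝓘(ℝ, E) ∞ N] {E' : Type*} [NormedAddCommGroup E']
    [NormedSpace ℝ E'] {Q' : Type*} [TopologicalSpace Q'] [ChartedSpace E' Q']
    [IsManifold 𝓘(ℝ, E') ∞ Q'] [IsManifold 𝓘(ℝ, B) ∞ Q] {f : N → Q} {u : N} {g : N → Q'}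
    (h : Manifold.IsSubmersionAtOfComplement G 𝓘(ℝ, E) 𝓘(ℝ, B) ∞ f u)
    (hf : MDifferentiable 𝓘(ℝ, E) 𝓘(ℝ, B) f) (hg : MDifferentiable 𝓘(ℝ, E) 𝓘(ℝ, E') g)
    (hker : ∀ v w, mfderiv 𝓘(ℝ, E) 𝓘(ℝ, B) f v w = 0 → mfderiv 𝓘(ℝ, E) 𝓘(ℝ, E') g v w = 0) :
    ∃ U ∈ 𝓝 u, ∀ v ∈ U, ∀ w ∈ U, f v = f w → g v = g w := by
  have : IsManifold 𝓘(ℝ, E') 1 Q' := .of_le (n := ∞) (by norm_cast)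
  set φ := h.domChart.extend 𝓘(ℝ, E) with hφ
  set ψ := h.codChart.extend 𝓘(ℝ, B) with hψ
  set χ : PartialEquiv Q' E' := extChartAt 𝓘(ℝ, E') (g u) with hχ
  have hw := h.writtenInCharts
  rw [← hφ, ← hψ] at hw
  have hφs : φ.source = h.domChart.source := by rw [hφ, OpenPartialHomeomorph.extend_source]
  have huφ : u ∈ φ.source := hφs ▸ h.mem_domChart_source
  have hmaps : ∀ v ∈ φ.source, f v ∈ ψ.source := by
    rw [hφ, hψ, OpenPartialHomeomorph.extend_source, OpenPartialHomeomorph.extend_source]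
    exact h.mapsto_domChart_source_codChart_source
  have hφt : IsOpen φ.target := by
    rw [hφ]; simpa using h.domChart.open_target
  have hsm : ContMDiffOn 𝓘(ℝ, E) 𝓘(ℝ, E) ∞ φ.symm φ.target :=
    contMDiffOn_extend_self h.domChart_mem_maximalAtlas
  have hgo : IsOpen (φ.target ∩ φ.symm ⁻¹' (g ⁻¹' χ.source)) :=
    hsm.continuousOn.isOpen_inter_preimage hφt
      ((isOpen_extChartAt_source (I := 𝓘(ℝ, E')) (g u)).preimage hg.continuous)
  have hnear : h.equiv.symm ⁻¹' (φ.target ∩ φ.symm ⁻¹' (g ⁻¹' χ.source)) ∈ 𝓝 (h.equiv (φ u)) := by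
    refine (hgo.preimage h.equiv.symm.continuous).mem_nhds ?_
    simp only [mem_preimage, ContinuousLinearEquiv.symm_apply_apply, mem_inter_iff,
      φ.left_inv huφ]
    exact ⟨φ.map_source huφ, mem_extChartAt_source (I := 𝓘(ℝ, E')) (g u)⟩
  obtain ⟨δ, hδ, hball⟩ := Metric.mem_nhds_iff.1 hnear
  have hφc : ContinuousOn φ φ.source := by
    rw [hφs]; exact (h.domChart.contMDiffOn_extend (h.domChart_mem_maximalAtlas)).continuousOn
  refine ⟨φ.source ∩ φ ⁻¹' (h.equiv ⁻¹' Metric.ball (h.equiv (φ u)) δ), ?_, ?_⟩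
  · refine (hφc.isOpen_inter_preimage (h.domChart.isOpen_extend_source)
      (Metric.isOpen_ball.preimage h.equiv.continuous)).mem_nhds ⟨huφ, ?_⟩
    exact Metric.mem_ball_self hδ
  rintro v ⟨hv, hvb⟩ w ⟨hw', hwb⟩ hvw
  set p := h.equiv (φ v) with hp
  set q := h.equiv (φ w) with hq
  have hpq : p.1 = q.1 := by
    have e1 := hw (φ.map_source hv)
    have e2 := hw (φ.map_source hw')
    simp only [Function.comp_apply, φ.left_inv hv] at e1
    simp only [Function.comp_apply, φ.left_inv hw'] at e2
    rw [hp, hq, ← e1, ← e2, hvw]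
  -- By `hpq` this segment moves only the fibre coordinate. Hence `f` is constant along it, its
  -- velocity lies in the kernel of `df`, and so `g` has zero derivative along it.
  let l : ℝ → E := fun t => h.equiv.symm (p + t • (q - p))
  have hl : ∀ t, HasDerivAt l (h.equiv.symm (q - p)) t := fun t => by
    have h1 : HasDerivAt (fun t : ℝ => p + t • (q - p)) (q - p) t := by
      simpa using ((hasDerivAt_id t).smul_const (q - p)).const_add p
    exact h.equiv.symm.toContinuousLinearMap.hasFDerivAt.comp_hasDerivAt t h1
  have hlb : ∀ t ∈ Icc (0 : ℝ) 1, l t ∈ φ.target ∩ φ.symm ⁻¹' (g ⁻¹' χ.source) := fun t ht =>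
    hball ((convex_ball _ _).add_smul_sub_mem hvb hwb ht)
  have hder : ∀ t ∈ Icc (0 : ℝ) 1,
      HasDerivWithinAt (fun t => χ (g (φ.symm (l t)))) 0 (Icc 0 1) t := by
    intro t ht
    have hcur := ((hsm.contMDiffAt (hφt.mem_nhds (hlb t ht).1)).mdifferentiableAt
      (by simp)).hasMFDerivAt.comp t (hl t).hasFDerivAt.hasMFDerivAt
    have hfc := (hf _).hasMFDerivAt.comp t hcur
    have hconst : (f ∘ φ.symm ∘ l) =ᶠ[𝓝 t] fun _ => f (φ.symm (l t)) := by
      have hev : ∀ᶠ τ in 𝓝 t, l τ ∈ φ.target :=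
        (hl t).continuousAt (hφt.mem_nhds (hlb t ht).1)
      filter_upwards [hev] with τ hτ
      refine ψ.injOn (hmaps _ (φ.map_target hτ)) (hmaps _ (φ.map_target (hlb t ht).1)) ?_
      have e1 := hw hτ
      have e2 := hw (hlb t ht).1
      change ψ (f (φ.symm (l τ))) = _ at e1
      change ψ (f (φ.symm (l t))) = _ at e2
      change ψ (f (φ.symm (l τ))) = ψ (f (φ.symm (l t)))
      rw [e1, e2]
      simp [l, hpq]
    have hz := (hfc.congr_of_eventuallyEq hconst.symm).mfderiv
    rw [mfderiv_const] at hz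
    have hz1 := congrArg (fun L : ℝ →L[ℝ] B => L 1) hz
    have hk := hker (φ.symm (l t)) _ hz1.symm
    have hgc := ((mdifferentiableAt_extChartAt (I := 𝓘(ℝ, E')) (x := g u)
      (by rw [← extChartAt_source 𝓘(ℝ, E')]; exact (hlb t ht).2)).hasMFDerivAt.comp _
      (hg _).hasMFDerivAt).comp t hcur
    have hgd : HasFDerivAt (fun t => χ (g (φ.symm (l t)))) (_ : ℝ →L[ℝ] E') t := hgc.hasFDerivAt
    refine (hgd.hasDerivAt.congr_deriv ?_).hasDerivWithinAt
    exact (congrArg (mfderiv 𝓘(ℝ, E') 𝓘(ℝ, E') χ (g (φ.symm (l t)))) hk).trans (map_zero _)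
  have hfin := (convex_Icc (0 : ℝ) 1).norm_image_sub_le_of_norm_hasDerivWithin_le (C := 0) hder
    (by simp) (left_mem_Icc.2 zero_le_one) (right_mem_Icc.2 zero_le_one)
  have hfin' : χ (g (φ.symm (l 1))) = χ (g (φ.symm (l 0))) := by
    rw [← sub_eq_zero, ← norm_le_zero_iff]; simpa using hfin
  have l0 : φ.symm (l 0) = v := by simp [l, hp, φ.left_inv hv]
  have l1 : φ.symm (l 1) = w := by simp [l, hq, φ.left_inv hw']
  have m0 := (hlb 0 (left_mem_Icc.2 zero_le_one)).2
  have m1 := (hlb 1 (right_mem_Icc.2 zero_le_one)).2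
  rw [mem_preimage, l0] at m0
  rw [mem_preimage, l1] at m1
  rw [l0, l1] at hfin'
  exact (χ.injOn m1 m0 hfin').symm

end Submersion

/-! ### Separation, connectedness and alternating forms. -/

section Auxiliary

/-- Serves to make `Σ` Hausdorff, so that integral curves are unique. Points that cannot be
separated have the same base point, and a trivialization then separates them. -/
theorem t2Space_totalSpace {B F : Type*} [TopologicalSpace B] [T2Space B] [TopologicalSpace F]
    [T2Space F] (V : B → Type*) [TopologicalSpace (Bundle.TotalSpace F V)]
    [∀ b, TopologicalSpace (V b)] [FiberBundle F V] : T2Space (Bundle.TotalSpace F V) := by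
  rw [t2_iff_nhds]
  intro x y hxy
  have hproj := FiberBundle.continuous_proj F V
  have hb : x.proj = y.proj := by
    have h := hxy.map (Bundle.TotalSpace.proj)
    exact eq_of_nhds_neBot (h.mono (Filter.map_inf_le.trans
      (inf_le_inf (hproj.tendsto x) (hproj.tendsto y))))
  let e := trivializationAt F V x.proj
  have hx : x ∈ e.source := FiberBundle.mem_trivializationAt_proj_source
  have hy : y ∈ e.source := by
    rw [e.mem_source, ← hb]; exact FiberBundle.mem_baseSet_trivializationAt' x.proj
  refine e.toOpenPartialHomeomorph.injOn hx hy ?_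
  have h := hxy.map e.toOpenPartialHomeomorph
  exact eq_of_nhds_neBot (h.mono (Filter.map_inf_le.trans
    (inf_le_inf (e.continuousAt hx) (e.continuousAt hy))))

/-- Radial projection `v ↦ (gauge K v)⁻¹ • v` maps the unit sphere continuously onto the frontier,
which is the level set of the gauge at 1. -/
theorem isConnected_frontier_of_convex {E : Type*} [NormedAddCommGroup E] [NormedSpace ℝ E]
    (hE : 1 < Module.rank ℝ E) {K : Set E} (hK : Convex ℝ K) (hb : Bornology.IsBounded K)
    (h0 : (0 : E) ∈ interior K) : IsConnected (frontier K) := by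
  have h0' : K ∈ 𝓝 (0 : E) := mem_interior_iff_mem_nhds.1 h0
  have hpos : ∀ x ≠ 0, 0 < gauge K x := fun x hx =>
    (gauge_pos (absorbent_nhds_zero h0') (NormedSpace.isVonNBounded_of_isBounded ℝ hb)).2 hx
  have hc := (isConnected_sphere hE (0 : E) zero_le_one).image (fun v => (gauge K v)⁻¹ • v) (by
    refine ContinuousOn.smul (ContinuousOn.inv₀ (continuous_gauge hK h0').continuousOn ?_)
      continuousOn_id
    intro v hv
    exact (hpos v (ne_zero_of_mem_unit_sphere ⟨v, hv⟩)).ne')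
  convert hc using 1
  ext y
  rw [← gauge_eq_one_iff_mem_frontier hK h0']
  constructor
  · intro hy
    have hy0 : y ≠ 0 := by rintro rfl; simp at hy
    have hn : ‖y‖ ≠ 0 := norm_ne_zero_iff.2 hy0
    refine ⟨‖y‖⁻¹ • y, by simp [norm_smul, hn], ?_⟩
    simp only [gauge_smul_of_nonneg (inv_nonneg.2 (norm_nonneg y)), hy, smul_smul, smul_eq_mul]
    simp [hn]
  · rintro ⟨v, hv, rfl⟩
    have := hpos v (ne_zero_of_mem_unit_sphere ⟨v, hv⟩)
    simp only [gauge_smul_of_nonneg (inv_nonneg.2 this.le), smul_eq_mul]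
    exact inv_mul_cancel₀ this.ne'

theorem isConnected_frontier_convexHull {E : Type*} [NormedAddCommGroup E] [NormedSpace ℝ E]
    (hE : 1 < Module.rank ℝ E) {S : Set E} (hS : IsCompact S)
    (h0 : (0 : E) ∈ interior (convexHull ℝ S)) : IsConnected (frontier (convexHull ℝ S)) :=
  isConnected_frontier_of_convex hE (convex_convexHull ℝ S) (isBounded_convexHull.2 hS.isBounded) h0

/-- The vectors `a`, `b` form a basis, and pairing with them reads off the coordinates of `v` up to
the factor `±θ ![a, b]`. -/
theorem eq_zero_of_alternating_pair {V : Type*} [AddCommGroup V] [Module ℝ V]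
    (hV : Module.finrank ℝ V = 2) (θ : V [⋀^Fin 2]→ₗ[ℝ] ℝ) {a b v : V} (hab : θ ![a, b] ≠ 0)
    (ha : θ ![v, a] = 0) (hb : θ ![v, b] = 0) : v = 0 := by
  have hli : LinearIndependent ℝ ![a, b] := by
    by_contra h
    exact hab (θ.map_linearDependent _ h)
  have hspan := hli.span_eq_top_of_card_eq_finrank (by simp [hV])
  have hv : v ∈ Submodule.span ℝ (range ![a, b]) := hspan ▸ Submodule.mem_top
  rw [Matrix.range_cons_cons_empty, Submodule.mem_span_pair] at hv
  obtain ⟨s, t, rfl⟩ := hv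
  have hlin : ∀ y, θ ![s • a + t • b, y] = s * θ ![a, y] + t * θ ![b, y] := fun y => by
    have h1 := θ.map_update_add ![0, y] 0 (s • a) (t • b)
    have h2 := θ.map_update_smul ![0, y] 0 s a
    have h3 := θ.map_update_smul ![0, y] 0 t b
    have hu : ∀ z, Function.update ![0, y] 0 z = ![z, y] := fun z => by
      ext i; fin_cases i <;> simp
    simp only [hu] at h1 h2 h3
    rw [h1, h2, h3, smul_eq_mul, smul_eq_mul]
  have hself : ∀ y, θ ![y, y] = 0 := fun y => θ.map_eq_zero_of_eq _ (i := 0) (j := 1) rfl (by simp)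
  have hswap : θ ![b, a] = -θ ![a, b] := by
    have := θ.map_swap ![a, b] (i := 0) (j := 1) (by simp)
    rw [← this]; congr 1; ext i; fin_cases i <;> simp
  rw [hlin, hself, hswap] at ha
  rw [hlin, hself] at hb
  have hs : s = 0 := by simpa [hab] using hb
  have ht : t = 0 := by simpa [hab, hs] using ha
  simp [hs, ht]

end Auxiliary

/-! ### The projection Σ → M and maps that factor through it. -/

namespace FinslerStructure

variable (F : FinslerStructure M)

theorem t2Space_carrier [T2Space M] : T2Space F.carrier := by
  have : T2Space (TangentBundle (𝓡 2) M) := t2Space_totalSpace (TangentSpace (𝓡 2))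
  infer_instance

theorem contMDiff_proj : ContMDiff (𝓡 3) (𝓡 2) ∞ F.proj :=
  (Bundle.contMDiff_proj (TangentSpace (𝓡 2))).comp F.embedding.contMDiff

theorem mdifferentiable_proj : MDifferentiable (𝓡 3) (𝓡 2) F.proj :=
  F.contMDiff_proj.mdifferentiable (by simp)

theorem exists_section (u : F.carrier) : ∃ (O : Set M) (σ : M → F.carrier), IsOpen O ∧
    F.proj u ∈ O ∧ ContMDiffOn (𝓡 2) (𝓡 3) ∞ σ O ∧ σ (F.proj u) = u ∧
    ∀ x ∈ O, F.proj (σ x) = x :=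
  exists_local_section (F.submersion.isSubmersionAt u).isSubmersionAtOfComplement_complement

theorem isConnected_fiberOf (x : M) : IsConnected (fiberOf F.carrier x) := by
  rw [← F.frontier_convexHull x]
  exact isConnected_frontier_convexHull (E := EuclideanSpace ℝ (Fin 2))
    (by rw [← Module.finrank_eq_rank]; simp) (F.isCompact_fiber x) (F.zero_mem x)

theorem isPreconnected_proj_fiber (x : M) : IsPreconnected (F.proj ⁻¹' {x}) := by
  have hval : Topology.IsInducing (Subtype.val : F.carrier → TangentBundle (𝓡 2) M) :=
    Topology.IsInducing.subtypeVal
  rw [← hval.isPreconnected_image]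
  have hc : Continuous (fun v : TangentSpace (𝓡 2) x => (⟨x, v⟩ : TangentBundle (𝓡 2) M)) :=
    FiberBundle.continuous_totalSpaceMk (EuclideanSpace ℝ (Fin 2)) (TangentSpace (𝓡 2)) x
  convert (F.isConnected_fiberOf x).isPreconnected.image _ hc.continuousOn using 1
  ext ⟨y, v⟩
  constructor
  · rintro ⟨⟨u, hu⟩, hux, rfl⟩
    obtain rfl : y = x := hux
    exact ⟨v, hu, rfl⟩
  · rintro ⟨w, hw, h⟩
    cases h
    exact ⟨⟨_, hw⟩, rfl, rfl⟩

/-- A map on `Σ` whose differential vanishes on vertical vectors factors through `M`. -/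
theorem exists_factor_of_vertical {E' : Type*} [NormedAddCommGroup E'] [NormedSpace ℝ E']
    {Q : Type*} [TopologicalSpace Q] [ChartedSpace E' Q] [IsManifold 𝓘(ℝ, E') ∞ Q]
    {g : F.carrier → Q} (hg : ContMDiff (𝓡 3) 𝓘(ℝ, E') ∞ g)
    (hker : ∀ u w, mfderiv (𝓡 3) (𝓡 2) F.proj u w = 0 → mfderiv (𝓡 3) 𝓘(ℝ, E') g u w = 0) :
    ∃ f : M → Q, ContMDiff (𝓡 2) 𝓘(ℝ, E') ∞ f ∧ ∀ u, f (F.proj u) = g u := by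
  have hconst : ∀ u v, F.proj u = F.proj v → g u = g v := by
    intro u v huv
    have hpre := isPreconnected_iff_preconnectedSpace.1 (F.isPreconnected_proj_fiber (F.proj v))
    let G : (F.proj ⁻¹' {F.proj v} : Set F.carrier) → Q := fun w => g w.1
    have hG : IsLocallyConstant G := by
      rw [IsLocallyConstant.iff_eventually_eq]
      intro w
      obtain ⟨U, hU, hUc⟩ := exists_nhds_const_on_fibers
        (F.submersion.isSubmersionAt w.1).isSubmersionAtOfComplement_complement
        F.mdifferentiable_proj (hg.mdifferentiable (by simp)) hker
      filter_upwards [continuous_subtype_val.continuousAt.preimage_mem_nhds hU] with y hy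
      exact hUc _ hy _ (mem_of_mem_nhds hU) (y.2.trans w.2.symm)
    exact hG.apply_eq_of_isPreconnected isPreconnected_univ (x := ⟨u, huv⟩) (y := ⟨v, rfl⟩)
      (mem_univ _) (mem_univ _)
  choose s hs using F.surjective
  have hf : ∀ u, g (s (F.proj u)) = g u := fun u => hconst _ _ (hs _)
  refine ⟨fun x => g (s x), fun x => ?_, hf⟩
  -- The set-theoretic choice `s` need not be continuous; since `g` is constant on fibres, the
  -- factor agrees locally with `g ∘ σ` for a smooth section `σ`.
  obtain ⟨O, σ, hO, hxO, hσ, -, hsec⟩ := F.exists_section (s x)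
  have hx : F.proj (s x) = x := hs x
  rw [hx] at hxO
  have h := (hg.comp_contMDiffOn hσ).contMDiffAt (hO.mem_nhds hxO)
  refine h.congr_of_eventuallyEq ?_
  filter_upwards [hO.mem_nhds hxO] with y hy
  rw [Function.comp_apply, ← hf (σ y), hsec y hy]

/-! ### The geodesic vector field and its flow. -/

namespace Coframing

variable {F} {η : F.Coframing} {Ω : PositiveTwoForm M}

/-- A positive multiple of `Ω` pulls back to ω₁ ∧ ω₂. One direction tests this identity on X₁ and
X₂; the other uses that their projections have nonzero area. -/
theorem mfderiv_proj_eq_zero_iff (hη : F.IsCanonicalCoframing Ω η) {u : F.carrier}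
    {v : TangentSpace (𝓡 3) u} :
    mfderiv (𝓡 3) (𝓡 2) F.proj u v = 0 ↔ η.ω₁ u v = 0 ∧ η.ω₂ u v = 0 := by
  obtain ⟨r, hr, h⟩ := hη.positive u
  constructor
  · intro hv
    have hz : ∀ w, η.ω₁ u v * η.ω₂ u w - η.ω₁ u w * η.ω₂ u v = 0 := fun w => by
      rw [h, hv, (Ω.toForm _).map_coord_zero 0 (by simp), mul_zero]
    have h1 := hz (η.frame (0, 1, 0) u)
    have h2 := hz (η.frame (1, 0, 0) u)
    rw [ω₁_frame, ω₂_frame] at h1 h2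
    exact ⟨by simpa using h1, by simpa using h2⟩
  · rintro ⟨h1, h2⟩
    have hz : ∀ w, Ω.toForm (F.proj u)
        ![mfderiv (𝓡 3) (𝓡 2) F.proj u v, mfderiv (𝓡 3) (𝓡 2) F.proj u w] = 0 := fun w => by
      have := h v w
      rw [h1, h2] at this
      simpa [hr.ne'] using this.symm
    refine eq_zero_of_alternating_pair ?_ (Ω.toForm (F.proj u))
      (a := mfderiv (𝓡 3) (𝓡 2) F.proj u (η.frame (1, 0, 0) u))
      (b := mfderiv (𝓡 3) (𝓡 2) F.proj u (η.frame (0, 1, 0) u)) ?_ (hz _) (hz _)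
    · exact finrank_euclideanSpace_fin (𝕜 := ℝ) (n := 2)
    · intro h0
      have := h (η.frame (1, 0, 0) u) (η.frame (0, 1, 0) u)
      rw [h0] at this
      simp [ω₁_frame, ω₂_frame] at this

/-- Through every unit vector passes (the lift of) a unit speed curve. -/
theorem exists_isTangentialLift (u : F.carrier) : ∃ (γ : ℝ → M) (c : ℝ → F.carrier) (s : Set ℝ),
    IsOpen s ∧ (0 : ℝ) ∈ s ∧ F.IsTangentialLift γ c s ∧ c 0 = u ∧
    ∀ t ∈ s, F.proj (c t) = γ t := by
  obtain ⟨O, σ, hO, huO, hσ, hσu, hsec⟩ := F.exists_section u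
  -- A local section of `Σ` is a vector field of unit vectors, so its integral curves are unit speed
  -- curves whose lift is `σ ∘ γ`.
  let V : (x : M) → TangentSpace (𝓡 2) x := fun x => ((σ x).1.snd : EuclideanSpace ℝ (Fin 2))
  have hVσ : ∀ x ∈ O, (⟨x, V x⟩ : TangentBundle (𝓡 2) M) = (σ x).1 := by
    intro x hx
    have key : ∀ (p : TangentBundle (𝓡 2) M), p.proj = x →
        (⟨x, (p.snd : EuclideanSpace ℝ (Fin 2))⟩ : TangentBundle (𝓡 2) M) = p := by
      rintro ⟨_, _⟩ rfl; rfl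
    exact key _ (hsec x hx)
  have hV : ContMDiffOn (𝓡 2) (𝓡 2).tangent ∞ (fun x => (⟨x, V x⟩ : TangentBundle (𝓡 2) M)) O :=
    (F.embedding.contMDiff.comp_contMDiffOn hσ).congr hVσ
  have : IsManifold (𝓡 2) 1 M := .of_le (n := ∞) (by norm_cast)
  obtain ⟨γ, hγ0, hγ⟩ := exists_isMIntegralCurveAt_of_contMDiffAt_boundaryless 0
    ((hV.contMDiffAt (hO.mem_nhds huO)).of_le (by norm_cast))
  have hγO : ∀ᶠ t in 𝓝 (0 : ℝ), γ t ∈ O :=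
    hγ.continuousAt.preimage_mem_nhds (hO.mem_nhds (by rwa [hγ0]))
  obtain ⟨s, hs, hso, h0s⟩ := _root_.eventually_nhds_iff.1 (hγ.and hγO)
  -- The equation `γ' = V(γ)` is a total differential equation with the single form `dt`, so
  -- bootstrapping makes `γ` smooth.
  have hsm : ContMDiffOn 𝓘(ℝ, ℝ) (𝓡 2) ∞ γ s :=
    contMDiffOn_of_hasMFDerivAt_sum (ι := Unit) (θ := fun _ _ => (1 : ℝ →L[ℝ] ℝ)) (Z := fun _ => V)
      (fun _ => contMDiff_snd_tangentBundle_modelSpace ℝ 𝓘(ℝ, ℝ)) hO (fun _ => hV) hso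
      (fun t ht => (hs t ht).2) (fun t ht => (hs t ht).1.congr_mfderiv
        (Fintype.sum_unique (fun _ : Unit => (1 : ℝ →L[ℝ] ℝ).smulRight (V (γ t)))).symm)
  refine ⟨γ, fun t => σ (γ t), s, hso, h0s, ⟨hsm, hσ.comp hsm fun t ht => (hs t ht).2, ?_⟩, ?_, ?_⟩
  · intro t ht
    rw [← hVσ _ (hs t ht).2, (hs t ht).1.mfderiv]
    congr 1
    exact (one_smul ℝ _).symm
  · simp only [hγ0, hσu]
  · exact fun t ht => hsec _ (hs t ht).2

/-- The vector field `X₁` is a second order differential equation. -/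
theorem tangentMap_proj_X₁ (hη : F.IsCanonicalCoframing Ω η) (u : F.carrier) :
    tangentMap (𝓡 3) (𝓡 2) F.proj ⟨u, η.X₁ u⟩ = u.1 := by
  obtain ⟨γ, c, s, hs, h0, hc, rfl, hproj⟩ := exists_isTangentialLift u
  obtain ⟨e2, e1⟩ := hη.lift γ c s hs hc 0 h0
  -- The velocity of the lift and X₁ have the same ω₁ and ω₂, so they differ by a vertical vector.
  have hX : mfderiv (𝓡 3) (𝓡 2) F.proj (c 0) (F.velocity c 0 - η.X₁ (c 0)) = 0 := by
    rw [mfderiv_proj_eq_zero_iff hη, map_sub, map_sub, e1, e2]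
    exact ⟨sub_eq_zero.2 (η.ω₁_frame (1, 0, 0) _).symm, by
      rw [zero_sub, neg_eq_zero]; exact η.ω₂_frame (1, 0, 0) _⟩
  rw [map_sub, sub_eq_zero] at hX
  have hcd : MDifferentiableAt 𝓘(ℝ, ℝ) (𝓡 3) c 0 :=
    (hc.smooth_lift.contMDiffAt (hs.mem_nhds h0)).mdifferentiableAt (by simp)
  have hcomp := (F.mdifferentiable_proj _).hasMFDerivAt.comp 0 hcd.hasMFDerivAt
  have hev : F.proj ∘ c =ᶠ[𝓝 0] γ := by
    filter_upwards [hs.mem_nhds h0] with t ht using hproj t ht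
  have hm := (hcomp.congr_of_eventuallyEq hev.symm).mfderiv
  rw [hc.lift_eq 0 h0, hm]
  have hγ := hproj 0 h0
  have key : ∀ x, F.proj (c 0) = x → ∀ v w : EuclideanSpace ℝ (Fin 2), v = w →
      (⟨F.proj (c 0), v⟩ : TangentBundle (𝓡 2) M) = ⟨x, w⟩ := by rintro _ rfl _ _ rfl; rfl
  exact key _ hγ _ _ hX.symm

section Flow

variable (hc : η.IsComplete)

theorem flow_zero (u : F.carrier) : flow hc 0 u = u := (Classical.choose_spec (hc u)).1

theorem isMIntegralCurve_flow (u : F.carrier) : IsMIntegralCurve (fun t => flow hc t u) η.X₁ :=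
  (Classical.choose_spec (hc u)).2

theorem contMDiffOn_of_isMIntegralCurve {c : ℝ → F.carrier} (h : IsMIntegralCurve c η.X₁) :
    ContMDiffOn 𝓘(ℝ, ℝ) (𝓡 3) ∞ c univ :=
  contMDiffOn_of_hasMFDerivAt_sum (ι := Unit) (θ := fun _ _ => (1 : ℝ →L[ℝ] ℝ))
    (Z := fun _ => η.X₁) (fun _ => contMDiff_snd_tangentBundle_modelSpace ℝ 𝓘(ℝ, ℝ)) isOpen_univ
    (fun _ => (η.isSmooth_frame (1, 0, 0)).contMDiffOn) isOpen_univ (fun _ _ => mem_univ _)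
    (fun t _ => (h t).congr_mfderiv
      (Fintype.sum_unique (fun _ : Unit => (1 : ℝ →L[ℝ] ℝ).smulRight (η.X₁ (c t)))).symm)

variable [T2Space M]

theorem hasMFDerivAt_flow (hK : η.HasCurvature (fun _ => 1)) (t : ℝ) (u : F.carrier) :
    HasMFDerivAt (𝓡 3) (𝓡 3) (flow hc t) u (frameRotation η.X₁ (η.frame (0, 1, 0))
      (η.frame (0, 0, 1)) η.ω₁ η.ω₂ η.ω₃ t u (flow hc t u)) :=
  haveI := F.t2Space_carrier
  (η.isRotationFrame hK).hasMFDerivAt_flow (flow_zero hc) (isMIntegralCurve_flow hc) t u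

theorem flow_add (hK : η.HasCurvature (fun _ => 1)) (s t : ℝ) (u : F.carrier) : flow hc (s + t) u = flow hc s (flow hc t u) :=
  haveI := F.t2Space_carrier
  (η.isRotationFrame hK).flow_add (flow_zero hc) (isMIntegralCurve_flow hc) s t u

theorem contMDiff_flow (hK : η.HasCurvature (fun _ => 1)) (t : ℝ) : ContMDiff (𝓡 3) (𝓡 3) ∞ (flow hc t) := by
  rw [← contMDiffOn_univ]
  have h := η.isRotationFrame hK
  have hs := η.isSmooth_frame
  refine contMDiffOn_of_hasMFDerivAt_sum (ι := Fin 3) (θ := ![η.ω₁, η.ω₂, η.ω₃])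
    (Z := ![η.X₁, η.frame (0, Real.cos t, -Real.sin t), η.frame (0, Real.sin t, Real.cos t)])
    ?_ isOpen_univ ?_ isOpen_univ (fun _ _ => mem_univ _) fun u _ => ?_
  · intro i; fin_cases i
    exacts [η.smooth₁, η.smooth₂, η.smooth₃]
  · intro i; fin_cases i
    exacts [(hs _).contMDiffOn, (hs _).contMDiffOn, (hs _).contMDiffOn]
  · refine (hasMFDerivAt_flow hc hK t u).congr_mfderiv ?_
    have e2 : Real.cos t • η.frame (0, 1, 0) (flow hc t u) -
        Real.sin t • η.frame (0, 0, 1) (flow hc t u) =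
        η.frame (0, Real.cos t, -Real.sin t) (flow hc t u) := by
      apply η.ext_coframe <;> simp [ω₁_frame, ω₂_frame, ω₃_frame]
    have e3 : Real.sin t • η.frame (0, 1, 0) (flow hc t u) +
        Real.cos t • η.frame (0, 0, 1) (flow hc t u) =
        η.frame (0, Real.sin t, Real.cos t) (flow hc t u) := by
      apply η.ext_coframe <;> simp [ω₁_frame, ω₂_frame, ω₃_frame]
    rw [Fin.sum_univ_three, frameRotation, e2, e3]
    rfl

end Flow

end Coframing
end FinslerStructure

/-! ### Geodesics and the antipodal map α. -/

namespace FinslerStructure.Coframing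

variable {F : FinslerStructure M} {η : F.Coframing} {Ω : PositiveTwoForm M}

section Flow

variable (hc : η.IsComplete)

theorem isUnitSpeedGeodesicOn_proj_flow (hη : F.IsCanonicalCoframing Ω η) (u : F.carrier) :
    η.IsUnitSpeedGeodesicOn (fun t => F.proj (flow hc t u)) univ := by
  have hsm := contMDiffOn_of_isMIntegralCurve (isMIntegralCurve_flow hc u)
  refine ⟨fun t => flow hc t u, ⟨F.contMDiff_proj.comp_contMDiffOn hsm, hsm, fun t _ => ?_⟩,
    fun t _ => ?_⟩
  · have h1 := isMIntegralCurve_flow hc u t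
    have h2 := ((F.mdifferentiable_proj _).hasMFDerivAt.comp t h1).mfderiv
    rw [← tangentMap_proj_X₁ hη (flow hc t u)]
    refine congrArg (Bundle.TotalSpace.mk _) ?_
    refine Eq.trans ?_ (congrArg (fun L : ℝ →L[ℝ] EuclideanSpace ℝ (Fin 2) => L 1) h2).symm
    exact congrArg (mfderiv (𝓡 3) (𝓡 2) F.proj (flow hc t u)) (one_smul ℝ _).symm
  · have h1 := (isMIntegralCurve_flow hc u t).mfderiv
    have h2 : F.velocity (fun t => flow hc t u) t = η.X₁ (flow hc t u) :=
      (congrArg (fun L : ℝ →L[ℝ] EuclideanSpace ℝ (Fin 3) => L 1) h1).trans (one_smul ℝ _)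
    rw [h2]
    exact η.ω₃_frame (1, 0, 0) _

theorem isMIntegralCurveOn_of_geodesic (hη : F.IsCanonicalCoframing Ω η) {γ : ℝ → M}
    {c : ℝ → F.carrier} {s : Set ℝ} (hs : IsOpen s) (hl : F.IsTangentialLift γ c s)
    (h3 : ∀ t ∈ s, η.ω₃ (c t) (F.velocity c t) = 0) : IsMIntegralCurveOn c η.X₁ s := by
  intro t ht
  have hd : MDifferentiableAt 𝓘(ℝ, ℝ) (𝓡 3) c t :=
    (hl.smooth_lift.contMDiffAt (hs.mem_nhds ht)).mdifferentiableAt (by simp)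
  obtain ⟨e2, e1⟩ := hη.lift γ c s hs hl t ht
  have hv : F.velocity c t = η.X₁ (c t) := by
    apply η.ext_coframe
    · rw [e1]; exact (η.ω₁_frame (1, 0, 0) _).symm
    · rw [e2]; exact (η.ω₂_frame (1, 0, 0) _).symm
    · rw [h3 t ht]; exact (η.ω₃_frame (1, 0, 0) _).symm
  refine (hd.hasMFDerivAt.congr_mfderiv ?_).hasMFDerivWithinAt
  refine ContinuousLinearMap.ext_ring ?_
  exact hv.trans (one_smul ℝ _).symm

variable [T2Space M]

theorem hasMFDerivAt_proj_flow (hK : η.HasCurvature (fun _ => 1)) (t : ℝ) (u : F.carrier) :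
    HasMFDerivAt (𝓡 3) (𝓡 2) (F.proj ∘ flow hc t) u
      ((mfderiv (𝓡 3) (𝓡 2) F.proj (flow hc t u)).comp (frameRotation η.X₁ (η.frame (0, 1, 0))
        (η.frame (0, 0, 1)) η.ω₁ η.ω₂ η.ω₃ t u (flow hc t u))) :=
  (F.mdifferentiable_proj _).hasMFDerivAt.comp u (hasMFDerivAt_flow hc hK t u)

/-- At times `t` with `sin t = 0`, the geodesic flow covers a map of `M`. -/
theorem exists_baseMap (hη : F.IsCanonicalCoframing Ω η) (hK : η.HasCurvature (fun _ => 1))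
    {t : ℝ} (ht : Real.sin t = 0) : ∃ f : M → M, ContMDiff (𝓡 2) (𝓡 2) ∞ f ∧
      ∀ u, f (F.proj u) = F.proj (flow hc t u) := by
  refine F.exists_factor_of_vertical (g := F.proj ∘ flow hc t)
    (F.contMDiff_proj.comp (contMDiff_flow hc hK t)) fun u w hw => ?_
  rw [(hasMFDerivAt_proj_flow hc hK t u).mfderiv]
  rw [mfderiv_proj_eq_zero_iff hη] at hw
  refine (mfderiv_proj_eq_zero_iff hη).2 ⟨?_, ?_⟩
  · exact ((η.isRotationFrame hK).frameRotation_θ₁ t u _ w).trans hw.1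
  -- Since `sin t = 0`, the ω₃-component of a vertical vector contributes nothing to ω₂ of its
  -- image.
  · refine ((η.isRotationFrame hK).frameRotation_θ₂ t u _ w).trans ?_
    rw [hw.2, ht, mul_zero, zero_mul, add_zero]

theorem tangentMap_flow_X₁ (hK : η.HasCurvature (fun _ => 1)) (t : ℝ) (u : F.carrier) :
    tangentMap (𝓡 3) (𝓡 3) (flow hc t) ⟨u, η.X₁ u⟩ = ⟨flow hc t u, η.X₁ (flow hc t u)⟩ := by
  rw [tangentMap, (hasMFDerivAt_flow hc hK t u).mfderiv]
  exact congrArg (Bundle.TotalSpace.mk _) ((η.isRotationFrame hK).frameRotation_X t u _)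

/-- A unit vector `u` is the projection of X₁ at `u`; the chain rule moves it through the flow,
which preserves X₁. -/
theorem tangentMap_baseMap (hη : F.IsCanonicalCoframing Ω η) (hK : η.HasCurvature (fun _ => 1))
    {t : ℝ} {f : M → M} (hf : MDifferentiable (𝓡 2) (𝓡 2) f)
    (hfπ : ∀ u, f (F.proj u) = F.proj (flow hc t u)) (u : F.carrier) :
    tangentMap (𝓡 2) (𝓡 2) f u.1 = (flow hc t u).1 := by
  have e : f ∘ F.proj = F.proj ∘ flow hc t := funext hfπ
  rw [← tangentMap_proj_X₁ hη u,
    ← tangentMap_comp_at _ (hf _) (F.mdifferentiable_proj _), e,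
    tangentMap_comp_at _ (F.mdifferentiable_proj _) (hasMFDerivAt_flow hc hK t u).mdifferentiableAt,
    tangentMap_flow_X₁ hc hK, tangentMap_proj_X₁ hη]

theorem exists_baseDiffeomorph (hη : F.IsCanonicalCoframing Ω η)
    (hK : η.HasCurvature (fun _ => 1)) : ∃ α : M ≃ₘ⟮𝓡 2, 𝓡 2⟯ M,
      (∀ u, α (F.proj u) = F.proj (flow hc Real.pi u)) ∧
      ∀ u, α.symm (F.proj u) = F.proj (flow hc (-Real.pi) u) := by
  obtain ⟨f, hf, hfπ⟩ := exists_baseMap hc hη hK Real.sin_pi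
  obtain ⟨g, hg, hgπ⟩ := exists_baseMap hc hη hK (t := -Real.pi) (by simp)
  refine ⟨⟨⟨f, g, fun x => ?_, fun x => ?_⟩, hf, hg⟩, hfπ, hgπ⟩
  · obtain ⟨u, rfl⟩ := F.surjective x
    change g (f (F.proj u)) = F.proj u
    rw [hfπ, hgπ, ← flow_add hc hK, neg_add_cancel, flow_zero]
  · obtain ⟨u, rfl⟩ := F.surjective x
    change f (g (F.proj u)) = F.proj u
    rw [hgπ, hfπ, ← flow_add hc hK, add_neg_cancel, flow_zero]

theorem isOrientationReversing_baseMap (hη : F.IsCanonicalCoframing Ω η)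
    (hK : η.HasCurvature (fun _ => 1)) {α : M ≃ₘ⟮𝓡 2, 𝓡 2⟯ M}
    (hα : ∀ u, α (F.proj u) = F.proj (flow hc Real.pi u)) : IsOrientationReversing Ω α := by
  intro x
  obtain ⟨u, rfl⟩ := F.surjective x
  change ∃ r : ℝ, r < 0 ∧ ∀ v w : TangentSpace (𝓡 2) (F.proj u), _
  obtain ⟨r, hr, h⟩ := hη.positive u
  obtain ⟨r', hr', h'⟩ := hη.positive (flow hc Real.pi u)
  have hR := η.isRotationFrame hK
  have e : α ∘ F.proj = F.proj ∘ flow hc Real.pi := funext hα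
  have hαd : MDifferentiableAt (𝓡 2) (𝓡 2) α (F.proj u) :=
    α.contMDiff.mdifferentiable (by simp) _
  have hcomp := (hαd.hasMFDerivAt.comp u (F.mdifferentiable_proj u).hasMFDerivAt).mfderiv
  rw [e, (hasMFDerivAt_proj_flow hc hK Real.pi u).mfderiv] at hcomp
  have hd : ∀ w : TangentSpace (𝓡 3) u,
      (mfderiv (𝓡 2) (𝓡 2) α (F.proj u) (mfderiv (𝓡 3) (𝓡 2) F.proj u w) :
        EuclideanSpace ℝ (Fin 2)) =
      mfderiv (𝓡 3) (𝓡 2) F.proj (flow hc Real.pi u) (frameRotation η.X₁ (η.frame (0, 1, 0))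
        (η.frame (0, 0, 1)) η.ω₁ η.ω₂ η.ω₃ Real.pi u (flow hc Real.pi u) w) := fun w =>
    congrArg (fun L : EuclideanSpace ℝ (Fin 3) →L[ℝ] EuclideanSpace ℝ (Fin 2) => L w) hcomp.symm
  -- Differentiate `F.proj ∘ σ = id` for a local section `σ` through `u`.
  have hsurj : ∀ v : TangentSpace (𝓡 2) (F.proj u), ∃ v', mfderiv (𝓡 3) (𝓡 2) F.proj u v' = v := by
    intro v
    obtain ⟨O, σ, hO, huO, hσ, hσu, hsec⟩ := F.exists_section u
    have h1 := ((hσ.contMDiffAt (hO.mem_nhds huO)).mdifferentiableAt (by simp)).hasMFDerivAt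
    have h2 := (F.mdifferentiable_proj (σ (F.proj u))).hasMFDerivAt.comp _ h1
    have h3 := (h2.congr_of_eventuallyEq (f₁ := id) (by
      filter_upwards [hO.mem_nhds huO] with y hy using (hsec y hy).symm)).mfderiv
    rw [mfderiv_id] at h3
    have key : ∀ p : F.carrier, p = u → ∀ A : EuclideanSpace ℝ (Fin 3),
        (mfderiv (𝓡 3) (𝓡 2) F.proj p A : EuclideanSpace ℝ (Fin 2)) = v →
        ∃ v', mfderiv (𝓡 3) (𝓡 2) F.proj u v' = v := by
      rintro _ rfl A hA
      exact ⟨A, hA⟩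
    exact key _ hσu _ (congrArg (fun L : EuclideanSpace ℝ (Fin 2) →L[ℝ] EuclideanSpace ℝ (Fin 2) =>
      L v) h3).symm
  -- The positive factors `r`, `r'` compare ω₁ ∧ ω₂ with `Ω` at `u` and at Ψ_π(u); the sign comes
  -- from `cos π = -1` acting on ω₂.
  refine ⟨-(r / r'), by simpa using div_pos hr hr', fun v w => ?_⟩
  obtain ⟨v, rfl⟩ := hsurj v
  obtain ⟨w, rfl⟩ := hsurj w
  have h1 := h v w
  have h2 := h' (frameRotation η.X₁ (η.frame (0, 1, 0))
        (η.frame (0, 0, 1)) η.ω₁ η.ω₂ η.ω₃ Real.pi u (flow hc Real.pi u) v)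
        (frameRotation η.X₁ (η.frame (0, 1, 0))
        (η.frame (0, 0, 1)) η.ω₁ η.ω₂ η.ω₃ Real.pi u (flow hc Real.pi u) w)
  rw [hR.frameRotation_θ₁, hR.frameRotation_θ₁, hR.frameRotation_θ₂, hR.frameRotation_θ₂,
    Real.cos_pi, Real.sin_pi] at h2
  have key : ∀ x, x = F.proj (flow hc Real.pi u) → ∀ a b a' b' : EuclideanSpace ℝ (Fin 2),
      a = a' → b = b' → (Ω.toForm x ![a, b] : ℝ) =
        Ω.toForm (F.proj (flow hc Real.pi u)) ![a', b'] := by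
    rintro _ rfl _ _ _ _ rfl rfl; rfl
  refine (key _ (hα u) _ _ _ _ (hd v) (hd w)).trans ?_
  have h3 := h1.symm.trans ((by ring : _ = -((η.ω₁ u v * (-1 * η.ω₂ u w + 0 * η.ω₃ u w) -
    η.ω₁ u w * (-1 * η.ω₂ u v + 0 * η.ω₃ u v)))).trans (congrArg Neg.neg h2))
  have fin : ∀ a b : ℝ, r * a = -(r' * b) → b = -(r / r') * a := fun a b hab => by
    have hr'0 := hr'.ne'
    field_simp
    linarith
  exact fin _ _ h3

theorem isIsometry_baseMap (hη : F.IsCanonicalCoframing Ω η)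
    (hK : η.HasCurvature (fun _ => 1)) {α : M ≃ₘ⟮𝓡 2, 𝓡 2⟯ M}
    (hα : ∀ u, α (F.proj u) = F.proj (flow hc Real.pi u))
    (hα' : ∀ u, α.symm (F.proj u) = F.proj (flow hc (-Real.pi) u)) : F.IsIsometry α := by
  have hd : MDifferentiable (𝓡 2) (𝓡 2) α := α.contMDiff.mdifferentiable (by simp)
  have hd' : MDifferentiable (𝓡 2) (𝓡 2) α.symm := α.symm.contMDiff.mdifferentiable (by simp)
  intro v
  constructor
  · intro hv
    -- If the image of `v` is a unit vector, the inverse map, whose derivative is Ψ_{-π} on Σ,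
    -- returns `v` to Σ.
    have e := tangentMap_baseMap hc hη hK hd' hα' ⟨_, hv⟩
    have e' : tangentMap (𝓡 2) (𝓡 2) α.symm (tangentMap (𝓡 2) (𝓡 2) α v) = v := by
      rw [← tangentMap_comp_at _ (hd' _) (hd _)]
      have : α.symm ∘ α = (id : M → M) := funext α.symm_apply_apply
      rw [this, tangentMap_id, id]
    rw [e'] at e
    rw [e]
    exact Subtype.property _
  · intro hv
    rw [tangentMap_baseMap hc hη hK hd hα ⟨v, hv⟩]
    exact Subtype.property _

theorem eqOn_flow_of_geodesic (hη : F.IsCanonicalCoframing Ω η) {γ : ℝ → M}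
    {c : ℝ → F.carrier} {s : Set ℝ} (hs : IsOpen s) (hs' : s.OrdConnected) (h0 : (0 : ℝ) ∈ s)
    (hl : F.IsTangentialLift γ c s) (h3 : ∀ t ∈ s, η.ω₃ (c t) (F.velocity c t) = 0) :
    EqOn (fun t => flow hc t (c 0)) c s := by
  intro t ht
  have := F.t2Space_carrier
  -- Openness gives room on both sides of 0 and `t`, so an open interval inside `s` contains both
  -- and uniqueness of integral curves applies there.
  have hint : ∀ x ∈ s, ∃ a b, a ∈ s ∧ b ∈ s ∧ a < x ∧ x < b := fun x hx => by
    obtain ⟨ε, hε, hb⟩ := Metric.isOpen_iff.1 hs x hx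
    refine ⟨x - ε / 2, x + ε / 2, hb ?_, hb ?_, by linarith, by linarith⟩ <;>
      simp [abs_of_pos hε, hε]
  obtain ⟨a, -, ha, -, ha0, -⟩ := hint (min 0 t) (by
    rcases min_choice 0 t with h | h <;> rw [h] <;> assumption)
  obtain ⟨-, b, -, hb, -, hb0⟩ := hint (max 0 t) (by
    rcases max_choice 0 t with h | h <;> rw [h] <;> assumption)
  have hsub : Ioo a b ⊆ s := Ioo_subset_Icc_self.trans (hs'.out ha hb)
  refine isMIntegralCurveOn_Ioo_eqOn_of_contMDiff_boundaryless (t₀ := 0) (a := a) (b := b)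
    ⟨ha0.trans_le (min_le_left _ _), (le_max_left _ _).trans_lt hb0⟩
    ((η.isSmooth_frame (1, 0, 0)).of_le (by norm_cast))
    ((isMIntegralCurve_flow hc (c 0)).isMIntegralCurveOn _)
    ((isMIntegralCurveOn_of_geodesic hη hs hl h3).mono hsub) (flow_zero hc _)
    ⟨ha0.trans_le (min_le_right _ _), (le_max_right _ _).trans_lt hb0⟩

end Flow

end FinslerStructure.Coframing
end Finsler
end

theorem mainTheorem7 {M : Type*} [TopologicalSpace M] [T2Space M] [ConnectedSpace M]
    [ChartedSpace (EuclideanSpace ℝ (Fin 2)) M] [IsManifold (𝓡 2) ∞ M]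
    (Ω : Finsler.PositiveTwoForm M) (F : Finsler.FinslerStructure M)
    (η : F.Coframing) (hη : F.IsCanonicalCoframing Ω η)
    (hK : η.HasCurvature (fun _ => 1)) (hc : η.IsComplete) :
    (∃! α : M ≃ₘ⟮𝓡 2, 𝓡 2⟯ M,
      Finsler.IsOrientationReversing Ω α ∧ F.IsIsometry α ∧
      ∀ u : F.carrier, tangentMap (𝓡 2) (𝓡 2) α u =
          Finsler.FinslerStructure.Coframing.flow hc Real.pi u) ∧
    ∀ α : M ≃ₘ⟮𝓡 2, 𝓡 2⟯ M,
      Finsler.IsOrientationReversing Ω α → F.IsIsometry α →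
      (∀ u : F.carrier, tangentMap (𝓡 2) (𝓡 2) α u =
          Finsler.FinslerStructure.Coframing.flow hc Real.pi u) →
      ∀ (p : M) (γ : ℝ → M) (s : Set ℝ), IsOpen s → s.OrdConnected → (0 : ℝ) ∈ s →
        η.IsUnitSpeedGeodesicOn γ s → γ 0 = p →
        ∃ δ : ℝ → M, η.IsUnitSpeedGeodesicOn δ Set.univ ∧ Set.EqOn δ γ s ∧ δ Real.pi = α p := by
  open Finsler FinslerStructure Coframing in
  have hbase : ∀ (α : M ≃ₘ⟮𝓡 2, 𝓡 2⟯ M), (∀ u : F.carrier, tangentMap (𝓡 2) (𝓡 2) α u =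
      flow hc Real.pi u) → ∀ u : F.carrier, α (F.proj u) = F.proj (flow hc Real.pi u) :=
    fun α hα u => congrArg Bundle.TotalSpace.proj (hα u)
  refine ⟨?_, ?_⟩
  · obtain ⟨α, hα, hα'⟩ := exists_baseDiffeomorph hc hη hK
    refine ⟨α, ⟨isOrientationReversing_baseMap hc hη hK hα, isIsometry_baseMap hc hη hK hα hα',
      tangentMap_baseMap hc hη hK (α.contMDiff.mdifferentiable (by simp)) hα⟩, ?_⟩
    rintro β ⟨-, -, hβ⟩
    refine Diffeomorph.ext fun x => ?_
    obtain ⟨u, rfl⟩ := F.surjective x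
    exact (hbase β hβ u).trans (hα u).symm
  · rintro α - - hα p γ s hs hs' h0 ⟨c, hl, h3⟩ rfl
    have hflow := eqOn_flow_of_geodesic hc hη hs hs' h0 hl h3
    have hcγ : ∀ t ∈ s, F.proj (c t) = γ t := fun t ht =>
      congrArg Bundle.TotalSpace.proj (hl.lift_eq t ht)
    refine ⟨fun t => F.proj (flow hc t (c 0)), isUnitSpeedGeodesicOn_proj_flow hc hη _, ?_, ?_⟩
    · intro t ht
      exact (congrArg F.proj (hflow ht)).trans (hcγ t ht)
    -- `α p` may be computed from any unit vector over `p`, in particular from the initial velocity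
    -- `c 0`.
    · rw [← hcγ 0 h0, hbase α hα]
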